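/- Let $m\in\mathbb N$. Consider a mechanical port-Hamiltonian system in the coordinates $(q,\eta)$, with data: an inertia matrix $M(q)=M(q)^\top\succ0$, a nonsingular matrix $T(q)\in\mathbb R^{m\times m}$, differentiable in $q$, with $T(q)T(q)^\top=M(q)^{-1}$, and a matrix $D(q,\eta)$ with $D+D^\top\succeq0$. Let $q^{\mathrm d}:\mathbb R\to\mathbb R^m$ be bounded and twice differentiable, put $\eta^{\mathrm d}(q,t)=T(q)^{-1}\dot q^{\mathrm d}(t)$, $\tilde q=q-q^{\mathrm d}(t)$, $\tilde\eta=\eta-\eta^{\mathrm d}(q,t)$, and consider the error system with input $v\in\mathbb R^m$ $$\begin{pmatrix}\dot{\tilde q}\\ \dot{\tilde\eta}\end{pmatrix}=\begin{pmatrix}0&T(q)\\-T(q)^\top&-D(q,\eta)\end{pmatrix}\begin{pmatrix}\nabla_{\tilde q}\tilde H\\ \nabla_{\tilde\eta}\tilde H\end{pmatrix}+\begin{pmatrix}0\\ I_m\end{pmatrix}v,\qquad \tilde H=\tfrac12\|\tilde\eta\|^2 .$$ Let $\phi:\mathbb R^m\times\mathbb R^m\to\mathbb R^m$ be $C^1$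 with $\phi(0,0)=0$ and with $\partial\phi/\partial\tilde q$, $\partial\phi/\partial\tilde\eta$ nonsingular everywhere; put $\sigma=\phi(\tilde q,\tilde\eta)$ and $$\tilde\Lambda(q,\tilde q,\tilde\eta)=\frac{\partial\phi}{\partial\tilde q}T(q)\frac{\partial\phi}{\partial\tilde\eta}^{\top}+\frac{\partial\phi}{\partial\tilde\eta}T(q)^\top\frac{\partial\phi}{\partial\tilde q}^{\top}.$$ For $U:\mathbb R^m\to\mathbb R$ consider the feedback $$v=-\frac{\partial\phi}{\partial\tilde\eta}^{-1}\tilde\Lambda(q,\tilde q,\tilde\eta)\nabla_\sigma U(\sigma)+D(q,\eta)\tilde\eta-\frac{\partial\phi}{\partial\tilde\eta}^{-1}\frac{\partial\phi}{\partial\tilde q}T(q)\tilde\eta .$$ (1) This feedback converts the error system into the closed-loop port-Hamiltonian system $$\begin{pmatrix}\dot{\tilde q}\\ \dot{\tilde\eta}\end{pmatrix}=\begin{pmatrix}-T\frac{\partial\phi}{\partial\tilde\eta}^{\top}\frac{\partial\phi}{\partial\tilde q}^{-\top}&T\\-T^\top&-\frac{\partial\phi}{\partial\tilde\eta}^{-1}\frac{\partial\phi}{\partial\tilde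 q}T\end{pmatrix}\begin{pmatrix}\nabla_{\tilde q}\tilde H_{\mathrm{smc}}\\ \nabla_{\tilde\eta}\tilde H_{\mathrm{smc}}\end{pmatrix},\qquad \tilde H_{\mathrm{smc}}=\tfrac12\|\tilde\eta\|^2+U(\phi(\tilde q,\tilde\eta)).$$ This holds, for any $U$, at every state where $U$ is differentiable at $\sigma$. It also holds for any locally Lipschitz $U$ at every state as an equality of sets, when $\nabla_\sigma U(\sigma)$ and $\nabla\tilde H_{\mathrm{smc}}$ range over Clarke's generalized gradients $\partial U(\sigma)$ and $\partial\tilde H_{\mathrm{smc}}(\tilde q,\tilde\eta)$. (2) Suppose moreover that $U$ is positive definite, locally Lipschitz, Clarke regular at every $\sigma\neq0$ (for instance convex, or $C^1$ away from $0$), and that there are $c>0$ and $0\le\rho<\frac12$ with $\|\xi\|\ge c\,U(\sigma)^\rho$ for all $\sigma\neq0$ and $\xi\in\partial U(\sigma)$; and that for some $\varepsilon>0$, $\tilde\Lambda(q,\tilde q,\tilde\eta)\succ\varepsilon I_m$ for all $q,\tilde q,\tilde\eta$. Solutions of the closed loop are locally absolutely continuous functions satisfying almost everywhere the differential inclusion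 in which $\nabla_\sigma U(\sigma)$ ranges over $\partial U(\sigma)$. Then: (a) there is a function $S$ of the error state such that every solution starting at time $t_0$ in the error state $x_0$ satisfies $\sigma(t)=0$ for all $t\ge t_0+S(x_0)$ in its interval of existence; (b) the origin of the closed-loop error system is asymptotically stable, uniformly in $t_0$. That is, it is Lyapunov stable; and from every initial state in some ball, solutions exist on $[t_0,\infty)$, every solution can be continued to $[t_0,\infty)$, and all solutions converge to the origin; (c) $\tilde H_{\mathrm{smc}}$ is a Lyapunov function: near the origin it is continuous and positive definite, and for some continuous positive definite $W$, $\tilde H_{\mathrm{smc}}(x(t))-\tilde H_{\mathrm{smc}}(x(s))\le-\int_s^tW(x(z))\,dz$ for $s\le t$ along all solutions $x=(\tilde q,\tilde\eta)$ that stay near the origin. -/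

import Mathlib

open Set Filter Topology MeasureTheory
open scoped InnerProductSpace InnerProduct

noncomputable section

namespace PBSMC

/-! ### Generalized gradients of locally Lipschitz functions -/

section Clarke

variable {E : Type*} [NormedAddCommGroup E] [InnerProductSpace ℝ E]

/-- Clarke's generalized directional derivative
`f°(x; v) = limsup_{y → x, h ↓ 0} (f (y + h v) - f y) / h`
(finite when `f` is Lipschitz near `x`). -/
def clarkeDeriv (f : E → ℝ) (x v : E) : ℝ :=
  limsup (fun p : E × ℝ => (f (p.1 + p.2 • v) - f p.1) / p.2) (𝓝 x ×ˢ 𝓝[>] (0 : ℝ))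

/-- Clarke's generalized gradient. It is `{∇ f x}` where `f` is `C¹`, and for `f = ‖·‖₁` it is the
set-valued signum. -/
def clarkeGradient (f : E → ℝ) (x : E) : Set E :=
  {ξ | ∀ v, ⟪ξ, v⟫_ℝ ≤ clarkeDeriv f x v}

/-- Clarke regularity at `x`: the one-sided directional derivatives exist and agree with
`f°(x; ·)`. Convex functions and `C¹` functions are regular. -/
def ClarkeRegularAt (f : E → ℝ) (x : E) : Prop :=
  ∀ v, Tendsto (fun h : ℝ => (f (x + h • v) - f x) / h) (𝓝[>] 0) (𝓝 (clarkeDeriv f x v))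

end Clarke

/-! ### Differential inclusions and stability of the origin -/

section Inclusion

variable {X : Type*} [NormedAddCommGroup X] [NormedSpace ℝ X]

/-- `x` is a solution of the time-varying differential inclusion `ẋ ∈ F(t, x)` on the interval `I`:
it is absolutely continuous on compact subintervals and satisfies the inclusion almost everywhere. -/
def IsSolutionOn (F : ℝ → X → Set X) (I : Set ℝ) (x : ℝ → X) : Prop :=
  (∀ a ∈ I, ∀ b ∈ I, a ≤ b → AbsolutelyContinuousOnInterval x a b) ∧
    ∀ᵐ t : ℝ, t ∈ I → ∃ x' : X, HasDerivAt x x' t ∧ x' ∈ F t (x t)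

/-- (Uniform) asymptotic stability of the origin of `ẋ ∈ F(t, x)`. -/
structure IsAsymptoticallyStable (F : ℝ → X → Set X) : Prop where
  /-- Lyapunov stability, for all solutions. -/
  stable : ∀ ε > 0, ∃ δ > 0, ∀ (t₀ τ : ℝ) (x : ℝ → X), IsSolutionOn F (Ico t₀ τ) x →
    ‖x t₀‖ < δ → ∀ t ∈ Ico t₀ τ, ‖x t‖ < ε
  /-- For initial states in some ball: solutions exist for all future times, every solution can
  be continued to all future times, and all solutions converge to the origin. -/
  attractive : ∃ r > 0,
    (∀ (t₀ : ℝ) (x₀ : X), ‖x₀‖ < r → ∃ x : ℝ → X, x t₀ = x₀ ∧ IsSolutionOn F (Ici t₀) x) ∧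
    (∀ (t₀ τ : ℝ) (x : ℝ → X), t₀ < τ → IsSolutionOn F (Ico t₀ τ) x → ‖x t₀‖ < r →
      ∃ y : ℝ → X, EqOn y x (Ico t₀ τ) ∧ IsSolutionOn F (Ici t₀) y) ∧
    (∀ ε > 0, ∃ S : ℝ, ∀ (t₀ τ : ℝ) (x : ℝ → X), IsSolutionOn F (Ico t₀ τ) x → ‖x t₀‖ < r →
      ∀ t ∈ Ico t₀ τ, t₀ + S ≤ t → ‖x t‖ < ε)

/-- `H` is a strict Lyapunov function of `ẋ ∈ F(t, x)` at the origin: near the origin it is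
continuous and positive definite, and `Ḣ ≤ -W(x)` (in integrated form) along all solutions, with a
continuous positive definite `W`. -/
def IsStrictLyapunov (F : ℝ → X → Set X) (H : X → ℝ) : Prop :=
  ∃ N ∈ 𝓝 (0 : X), ∃ W : X → ℝ, ContinuousOn H N ∧ ContinuousOn W N ∧ H 0 = 0 ∧ W 0 = 0 ∧
    (∀ x ∈ N, x ≠ 0 → 0 < H x ∧ 0 < W x) ∧
    ∀ (t₀ τ : ℝ) (x : ℝ → X), IsSolutionOn F (Ico t₀ τ) x → (∀ t ∈ Ico t₀ τ, x t ∈ N) →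
      ∀ s ∈ Ico t₀ τ, ∀ t ∈ Ico t₀ τ, s ≤ t → H (x t) - H (x s) ≤ -∫ z in s..t, W (x z)

end Inclusion

/-! ### The mechanical system and its error system -/

/-- `ℝ^m` with the Euclidean norm. -/
abbrev Vec (m : ℕ) : Type := EuclideanSpace ℝ (Fin m)

/-- `m × m` matrices, as linear maps of `ℝ^m`; the transpose is the adjoint. -/
abbrev Mat (m : ℕ) : Type := Vec m →L[ℝ] Vec m

/-- The error state `(q̃, η̃)`, in `ℝ^{2m}` with the Euclidean norm. -/
abbrev Phase (m : ℕ) : Type := WithLp 2 (Vec m × Vec m)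

/-- The block matrix `(A B; C D)` acting on `ℝ^{2m}`. -/
def block {m : ℕ} (A B C D : Mat m) (z : Phase m) : Phase m :=
  WithLp.toLp 2 (A z.fst + B z.snd, C z.fst + D z.snd)

/-- Data of the mechanical port-Hamiltonian system in the coordinates `(q, η = T(q)ᵀ p)`. -/
structure Plant (m : ℕ) where
  /-- inertia matrix -/
  M : Vec m → Mat m
  /-- factor of the inverse inertia matrix -/
  T : Vec m → Mat m
  /-- gyroscopic and damping term -/
  D : Vec m → Vec m → Mat m
  M_symm : ∀ q, (M q)† = M q
  M_pos : ∀ q v, v ≠ 0 → 0 < ⟪M q v, v⟫_ℝ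
  T_invertible : ∀ q, (T q).IsInvertible
  T_factor : ∀ q, T q ∘L (T q)† = (M q).inverse
  T_differentiable : Differentiable ℝ T
  D_nonneg : ∀ q η v, 0 ≤ ⟪(D q η + (D q η)†) v, v⟫_ℝ

section Controller

variable {m : ℕ} (P : Plant m) (qd : ℝ → Vec m) (φ : Vec m → Vec m → Vec m)

/-- The configuration `q = q̃ + q^d(t)`. -/
def config (t : ℝ) (x : Phase m) : Vec m := x.fst + qd t

/-- The target momentum `η^d(q, t) = T(q)⁻¹ q̇^d(t)`. -/
def targetMomentum (q : Vec m) (t : ℝ) : Vec m := (P.T q).inverse (deriv qd t)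

/-- The momentum `η = η̃ + η^d(q, t)`. -/
def momentum (t : ℝ) (x : Phase m) : Vec m := x.snd + targetMomentum P qd (config qd t x) t

/-- The Hamiltonian `½ ‖η̃‖²` of the error system. -/
def errorHamiltonian (x : Phase m) : ℝ := 1 / 2 * ‖x.snd‖ ^ 2

/-- Right-hand side of the error system with input `v`. -/
def errorField (t : ℝ) (x : Phase m) (v : Vec m) : Phase m :=
  block 0 (P.T (config qd t x)) (-(P.T (config qd t x))†)
      (-P.D (config qd t x) (momentum P qd t x)) (gradient errorHamiltonian x)
    + WithLp.toLp 2 (0, v)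

/-- Partial Jacobian `∂φ/∂q̃`. -/
def jacQ (x : Phase m) : Mat m := fderiv ℝ (fun a => φ a x.snd) x.fst

/-- Partial Jacobian `∂φ/∂η̃`. -/
def jacEta (x : Phase m) : Mat m := fderiv ℝ (fun b => φ x.fst b) x.snd

/-- `Λ̃(q, q̃, η̃)`. -/
def Lam (q : Vec m) (x : Phase m) : Mat m :=
  jacQ φ x ∘L P.T q ∘L (jacEta φ x)† + jacEta φ x ∘L (P.T q)† ∘L (jacQ φ x)†

/-- The feedback `v`, with `ξ` in the place of `∇U(σ)`. -/
def feedback (t : ℝ) (x : Phase m) (ξ : Vec m) : Vec m :=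
  -(jacEta φ x).inverse (Lam P φ (config qd t x) x ξ)
    + P.D (config qd t x) (momentum P qd t x) x.snd
    - (jacEta φ x).inverse (jacQ φ x (P.T (config qd t x) x.snd))

/-- The sliding variable `σ = φ(q̃, η̃)`. -/
def slidingVar (x : Phase m) : Vec m := φ x.fst x.snd

/-- The Hamiltonian `½ ‖η̃‖² + U(φ(q̃, η̃))`. -/
def smcHamiltonian (U : Vec m → ℝ) (x : Phase m) : ℝ :=
  1 / 2 * ‖x.snd‖ ^ 2 + U (φ x.fst x.snd)

/-- The structure matrix of the closed-loop port-Hamiltonian system, applied to `z`. -/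
def smcStructure (t : ℝ) (x : Phase m) (z : Phase m) : Phase m :=
  block (-(P.T (config qd t x) ∘L (jacEta φ x)† ∘L ((jacQ φ x)†).inverse))
    (P.T (config qd t x)) (-(P.T (config qd t x))†)
    (-((jacEta φ x).inverse ∘L jacQ φ x ∘L P.T (config qd t x))) z

/-- The error system under the feedback, as a differential inclusion: `∇U(σ)` ranges over the
generalized gradient. -/
def closedLoop (U : Vec m → ℝ) (t : ℝ) (x : Phase m) : Set (Phase m) :=
  (fun ξ => errorField P qd t x (feedback P qd φ t x ξ)) '' clarkeGradient U (slidingVar φ x)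

end Controller

/-- `U` is positive definite, locally Lipschitz, regular away from `0`, and
`‖∇U(σ)‖ ≥ c U(σ)^ρ` for `σ ≠ 0`, with constants `c > 0` and `0 ≤ ρ < 1/2`. -/
structure IsSlidingPotential {m : ℕ} (U : Vec m → ℝ) (c ρ : ℝ) : Prop where
  zero : U 0 = 0
  pos : ∀ σ, σ ≠ 0 → 0 < U σ
  lipschitz : LocallyLipschitz U
  regular : ∀ σ, σ ≠ 0 → ClarkeRegularAt U σ
  c_pos : 0 < c
  rho_nonneg : 0 ≤ ρ
  rho_lt : ρ < 1 / 2
  gradient_bound : ∀ σ, σ ≠ 0 → ∀ ξ ∈ clarkeGradient U σ, c * U σ ^ ρ ≤ ‖ξ‖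

end PBSMC

end

noncomputable section

namespace PBSMC

/-! ### Clarke calculus -/

/-! Write `ξ` for the chosen element of `∂U(σ)` and `J_q`, `J_η` for the partial Jacobians of `φ`.
The feedback cancels `D`.

Port-Hamiltonian form: the gradient of the closed-loop Hamiltonian is `(J_qᵀ ξ, η̃ + J_ηᵀ ξ)`, and
multiplying by the structure matrix gives the closed loop by pure algebra (`smcStructure_gradient`).
For nonsmooth `U` the same formula holds as an equality of sets, because `φ` is a submersion and the
Clarke chain rule is then exact (`clarkeDeriv_add_comp`, `clarkeGradient_smcHamiltonian`).

Reaching: along solutions `σ̇ = -Λ̃ ξ` (`slidingDeriv_loopField`). Regularity of `U` off the origin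
gives `d/dt U(σ) ≤ -⟪Λ̃ ξ, ξ⟫ ≤ -ε c² U(σ)^(2ρ)` almost everywhere while `σ ≠ 0`. Since `2ρ < 1`,
the function `U(σ)^(1-2ρ)` decreases at least linearly, and `σ` vanishes after a time fixed by the
initial state (`slidingVar_eq_zero_of_le`).

Stability: put `η̃ = J_ηᵀ u`. Completing the square in the power balance bounds the derivative of
the Hamiltonian by `-½ (⟪Λ̃ ξ, ξ⟫ + ⟪Λ̃ (u + ξ), u + ξ⟫)` (`inner_snd_loopField`). Near the origin
this is at most `-k` times the Hamiltonian (`dissipation_le`). The Hamiltonian is positive definite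
there, since `η̃ = 0` and `σ = 0` force `q̃ = 0`. So it is a strict Lyapunov function
(`exists_isStrictLyapunovOn`), and Lyapunov's direct method applies to the inclusion. Solutions
exist because its values are convex and bounded and its graph is closed
(`exists_lipschitz_solution`). -/

theorem limsup_eq_limsup_add_of_tendsto_sub {ι : Type*} {l : Filter ι} [l.NeBot] {f g : ι → ℝ}
    {c C : ℝ} (hg : ∀ᶠ i in l, |g i| ≤ C) (h : Tendsto (fun i => f i - g i) l (𝓝 c)) :
    limsup f l = limsup g l + c := by
  -- A real `limsup` is meaningful only for bounded families, so boundedness of both `g` and `f` is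
  -- secured before comparing.
  have hgb : IsBoundedUnder (· ≤ ·) l g :=
    ⟨C, by simpa using hg.mono fun i hi => (abs_le.1 hi).2⟩
  have hgc : IsCoboundedUnder (· ≤ ·) l g :=
    IsBoundedUnder.isCoboundedUnder_le ⟨-C, by simpa using hg.mono fun i hi => (abs_le.1 hi).1⟩
  have hf : ∀ᶠ i in l, |f i| ≤ C + |c| + 1 := by
    filter_upwards [hg, h (Metric.ball_mem_nhds c one_pos)] with i hi hi'
    have hi' : |f i - g i - c| < 1 := by rwa [mem_preimage, Metric.mem_ball, Real.dist_eq] at hi'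
    have h1 := abs_lt.1 hi'
    have h2 := abs_le.1 hi
    have h3 := neg_abs_le c
    have h4 := le_abs_self c
    exact abs_le.2 ⟨by linarith, by linarith⟩
  have hfb : IsBoundedUnder (· ≤ ·) l f :=
    ⟨_, by simpa using hf.mono fun i hi => (abs_le.1 hi).2⟩
  have hfc : IsCoboundedUnder (· ≤ ·) l f :=
    IsBoundedUnder.isCoboundedUnder_le
      ⟨-(C + |c| + 1), eventually_map.2 (hf.mono fun i hi => (abs_le.1 hi).1)⟩
  apply le_antisymm
  · refine le_of_forall_pos_lt_add fun ε hε => ?_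
    refine lt_of_le_of_lt (b := limsup g l + ε / 3 + (c + ε / 3)) ?_ (by linarith)
    refine limsup_le_of_le hfc ?_
    filter_upwards [eventually_lt_of_limsup_lt (by linarith : limsup g l < limsup g l + ε / 3) hgb,
      h (Iio_mem_nhds (by linarith : c < c + ε / 3))] with i h1 h2
    have h2 : f i - g i < c + ε / 3 := h2
    linarith
  · refine le_of_forall_pos_lt_add fun ε hε => ?_
    rw [← lt_sub_iff_add_lt]
    refine lt_of_le_of_lt (b := limsup f l + ε / 3 - (c - ε / 3)) ?_ (by linarith)
    refine limsup_le_of_le hgc ?_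
    filter_upwards [eventually_lt_of_limsup_lt (by linarith : limsup f l < limsup f l + ε / 3) hfb,
      h (Ioi_mem_nhds (by linarith : c - ε / 3 < c))] with i h1 h2
    have h2 : c - ε / 3 < f i - g i := h2
    linarith

section Clarke

variable {E : Type*} [NormedAddCommGroup E] [InnerProductSpace ℝ E] {f : E → ℝ} {x v w : E}

theorem tendsto_add_smul_nhds (x v : E) :
    Tendsto (fun p : E × ℝ => p.1 + p.2 • v) (𝓝 x ×ˢ 𝓝[>] (0 : ℝ)) (𝓝 x) := by
  have h : Tendsto (fun p : E × ℝ => p.1 + p.2 • v) (𝓝 (x, (0 : ℝ))) (𝓝 (x + (0 : ℝ) • v)) :=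
    Continuous.tendsto (by fun_prop) _
  rw [zero_smul, add_zero, nhds_prod_eq] at h
  exact h.mono_left (prod_mono le_rfl nhdsWithin_le_nhds)

theorem eventually_snd_pos {E : Type*} [TopologicalSpace E] (x : E) :
    ∀ᶠ p : E × ℝ in 𝓝 x ×ˢ 𝓝[>] (0 : ℝ), 0 < p.2 :=
  tendsto_snd.eventually self_mem_nhdsWithin

/-- One constant `K` serves all base points near `x` and all directions, because a neighbourhood of
`x` is also one of every nearby point. This uniformity yields local boundedness of the generalized
gradient. -/
theorem eventually_abs_quotient_le (hf : LocallyLipschitz f) (x : E) :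
    ∃ K : ℝ, 0 ≤ K ∧ ∀ᶠ y in 𝓝 x, ∀ v,
      ∀ᶠ p : E × ℝ in 𝓝 y ×ˢ 𝓝[>] (0 : ℝ), |(f (p.1 + p.2 • v) - f p.1) / p.2| ≤ K * ‖v‖ := by
  obtain ⟨K, s, hs, hK⟩ := hf x
  refine ⟨K, K.2, ?_⟩
  filter_upwards [eventually_eventually_nhds.2 hs] with y hy v
  filter_upwards [tendsto_add_smul_nhds y v hy, tendsto_fst hy, eventually_snd_pos y]
    with p h1 h2 h3
  have := hK.dist_le_mul _ h1 _ h2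
  rw [Real.dist_eq, dist_eq_norm, add_sub_cancel_left, norm_smul, Real.norm_of_nonneg h3.le] at this
  rw [abs_div, abs_of_pos h3, div_le_iff₀ h3]
  linarith

theorem isBoundedUnder_quotient (hf : LocallyLipschitz f) (x v : E) :
    IsBoundedUnder (· ≤ ·) (𝓝 x ×ˢ 𝓝[>] (0 : ℝ))
      (fun p : E × ℝ => (f (p.1 + p.2 • v) - f p.1) / p.2) := by
  obtain ⟨K, -, hK⟩ := eventually_abs_quotient_le hf x
  exact ⟨K * ‖v‖, by simpa using (hK.self_of_nhds v).mono fun i hi => (abs_le.1 hi).2⟩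

theorem isCoboundedUnder_quotient (hf : LocallyLipschitz f) (x v : E) :
    IsCoboundedUnder (· ≤ ·) (𝓝 x ×ˢ 𝓝[>] (0 : ℝ))
      (fun p : E × ℝ => (f (p.1 + p.2 • v) - f p.1) / p.2) := by
  obtain ⟨K, -, hK⟩ := eventually_abs_quotient_le hf x
  exact IsBoundedUnder.isCoboundedUnder_le
    ⟨-(K * ‖v‖), by simpa using (hK.self_of_nhds v).mono fun i hi => (abs_le.1 hi).1⟩

theorem eventually_quotient_lt (hf : LocallyLipschitz f) {c : ℝ} (h : clarkeDeriv f x v < c) :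
    ∀ᶠ p : E × ℝ in 𝓝 x ×ˢ 𝓝[>] (0 : ℝ), (f (p.1 + p.2 • v) - f p.1) / p.2 < c :=
  eventually_lt_of_limsup_lt h (isBoundedUnder_quotient hf x v)

theorem clarkeDeriv_le_of_eventually (hf : LocallyLipschitz f) {c : ℝ}
    (h : ∀ᶠ p : E × ℝ in 𝓝 x ×ˢ 𝓝[>] (0 : ℝ), (f (p.1 + p.2 • v) - f p.1) / p.2 ≤ c) :
    clarkeDeriv f x v ≤ c :=
  limsup_le_of_le (isCoboundedUnder_quotient hf x v) h

theorem eventually_clarkeDeriv_le_mul_norm (hf : LocallyLipschitz f) (x : E) :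
    ∃ K : ℝ, 0 ≤ K ∧ ∀ᶠ y in 𝓝 x, ∀ v, clarkeDeriv f y v ≤ K * ‖v‖ := by
  obtain ⟨K, hK0, hK⟩ := eventually_abs_quotient_le hf x
  refine ⟨K, hK0, hK.mono fun y hy v => clarkeDeriv_le_of_eventually hf ?_⟩
  exact (hy v).mono fun p hp => (abs_le.1 hp).2

theorem eventually_norm_le_of_mem_clarkeGradient (hf : LocallyLipschitz f) (x : E) :
    ∃ K : ℝ, 0 ≤ K ∧ ∀ᶠ y in 𝓝 x, ∀ ξ ∈ clarkeGradient f y, ‖ξ‖ ≤ K := by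
  obtain ⟨K, hK0, hK⟩ := eventually_clarkeDeriv_le_mul_norm hf x
  refine ⟨K, hK0, hK.mono fun y hy ξ hξ => ?_⟩
  rcases eq_or_ne ξ 0 with rfl | h0
  · simpa using hK0
  have h := (hξ ξ).trans (hy ξ)
  rw [real_inner_self_eq_norm_sq, sq] at h
  exact le_of_mul_le_mul_right h (norm_pos_iff.2 h0)

theorem exists_norm_le_of_mem_clarkeGradient (hf : LocallyLipschitz f) {s : Set E}
    (hs : IsCompact s) : ∃ K : ℝ, 0 ≤ K ∧ ∀ y ∈ s, ∀ ξ ∈ clarkeGradient f y, ‖ξ‖ ≤ K := by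
  refine hs.induction_on (p := fun s => ∃ K : ℝ, 0 ≤ K ∧ ∀ y ∈ s, ∀ ξ ∈ clarkeGradient f y, ‖ξ‖ ≤ K)
    ⟨0, le_rfl, by simp⟩ ?_ ?_ ?_
  · rintro s t hst ⟨K, hK0, hK⟩
    exact ⟨K, hK0, fun y hy => hK y (hst hy)⟩
  · rintro s t ⟨K, hK0, hK⟩ ⟨L, hL0, hL⟩
    refine ⟨max K L, le_max_of_le_left hK0, ?_⟩
    rintro y (hy | hy) ξ hξ
    · exact (hK y hy ξ hξ).trans (le_max_left _ _)
    · exact (hL y hy ξ hξ).trans (le_max_right _ _)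
  · intro x _
    obtain ⟨K, hK0, hK⟩ := eventually_norm_le_of_mem_clarkeGradient hf x
    exact ⟨_, mem_nhdsWithin_of_mem_nhds hK, K, hK0, fun y hy => hy⟩

theorem clarkeDeriv_add_le (hf : LocallyLipschitz f) (x v w : E) :
    clarkeDeriv f x (v + w) ≤ clarkeDeriv f x v + clarkeDeriv f x w := by
  refine le_of_forall_pos_lt_add fun ε hε => ?_
  refine lt_of_le_of_lt (b := (clarkeDeriv f x v + ε / 3) + (clarkeDeriv f x w + ε / 3)) ?_
    (by linarith)
  refine clarkeDeriv_le_of_eventually hf ?_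
  -- The increment along `v + w` splits at the shifted base point `y + h w`, which still tends to
  -- `x`. Letting the base point vary in the limsup is what makes `f°` subadditive.
  have ht : Tendsto (fun p : E × ℝ => (p.1 + p.2 • w, p.2)) (𝓝 x ×ˢ 𝓝[>] (0 : ℝ))
      (𝓝 x ×ˢ 𝓝[>] (0 : ℝ)) := (tendsto_add_smul_nhds x w).prodMk tendsto_snd
  filter_upwards [ht.eventually (eventually_quotient_lt hf
    (by linarith : clarkeDeriv f x v < clarkeDeriv f x v + ε / 3)),
    eventually_quotient_lt hf (by linarith : clarkeDeriv f x w < clarkeDeriv f x w + ε / 3)]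
    with p h1 h2
  have h3 : p.1 + p.2 • (v + w) = p.1 + p.2 • w + p.2 • v := by rw [smul_add]; abel
  rw [h3, ← sub_add_sub_cancel _ (f (p.1 + p.2 • w)), add_div]
  exact (add_lt_add h1 h2).le

theorem clarkeDeriv_smul_le (hf : LocallyLipschitz f) {c : ℝ} (hc : 0 < c) (x v : E) :
    clarkeDeriv f x (c • v) ≤ c * clarkeDeriv f x v := by
  refine le_of_forall_pos_lt_add fun ε hε => ?_
  refine lt_of_le_of_lt (b := c * (clarkeDeriv f x v + ε / (2 * c))) ?_ (by
    rw [mul_add]; gcongr; field_simp; linarith)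
  refine clarkeDeriv_le_of_eventually hf ?_
  have ht : Tendsto (fun p : E × ℝ => (p.1, p.2 * c)) (𝓝 x ×ˢ 𝓝[>] (0 : ℝ))
      (𝓝 x ×ˢ 𝓝[>] (0 : ℝ)) := by
    refine tendsto_fst.prodMk (tendsto_nhdsWithin_iff.2 ⟨?_, ?_⟩)
    · have : Tendsto (fun p : E × ℝ => p.2) (𝓝 x ×ˢ 𝓝[>] (0 : ℝ)) (𝓝 0) :=
        tendsto_snd.mono_right nhdsWithin_le_nhds
      simpa using this.mul_const c
    · exact (eventually_snd_pos x).mono fun p hp => mul_pos hp hc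
  have hlt : clarkeDeriv f x v < clarkeDeriv f x v + ε / (2 * c) := by
    have : 0 < ε / (2 * c) := by positivity
    linarith
  filter_upwards [ht.eventually (eventually_quotient_lt hf hlt), eventually_snd_pos x] with p h1 h2
  rw [smul_smul]
  have h3 : (f (p.1 + (p.2 * c) • v) - f p.1) / p.2
      = c * ((f (p.1 + (p.2 * c) • v) - f p.1) / (p.2 * c)) := by field_simp
  rw [h3]
  gcongr

theorem clarkeDeriv_smul (hf : LocallyLipschitz f) {c : ℝ} (hc : 0 < c) (x v : E) :
    clarkeDeriv f x (c • v) = c * clarkeDeriv f x v := by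
  refine le_antisymm (clarkeDeriv_smul_le hf hc x v) ?_
  have := clarkeDeriv_smul_le hf (inv_pos.2 hc) x (c • v)
  rw [smul_smul, inv_mul_cancel₀ hc.ne', one_smul, inv_mul_eq_div, le_div_iff₀ hc] at this
  linarith

theorem clarkeDeriv_zero (hf : LocallyLipschitz f) (x : E) : clarkeDeriv f x 0 = 0 := by
  have := clarkeDeriv_smul hf two_pos x (0 : E)
  rw [smul_zero] at this
  linarith

/-- Upper semicontinuity in the base point; it is the source of the closed graph of the generalized
gradient. -/
theorem eventually_clarkeDeriv_le (hf : LocallyLipschitz f) {c : ℝ} (h : clarkeDeriv f x v < c) :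
    ∀ᶠ y in 𝓝 x, clarkeDeriv f y v ≤ c := by
  obtain ⟨s, hs, t, ht, hst⟩ := mem_prod_iff.1 (eventually_quotient_lt hf h)
  filter_upwards [eventually_eventually_nhds.2 hs] with y hy
  refine clarkeDeriv_le_of_eventually hf ?_
  filter_upwards [prod_mem_prod hy ht] with p hp using le_of_lt (hst hp)

theorem isClosed_graph_clarkeGradient (hf : LocallyLipschitz f) :
    IsClosed {p : E × E | p.2 ∈ clarkeGradient f p.1} := by
  rw [← isOpen_compl_iff, isOpen_iff_mem_nhds]
  rintro ⟨x, ξ⟩ h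
  obtain ⟨v, hv⟩ : ∃ v, clarkeDeriv f x v < ⟪ξ, v⟫_ℝ := by
    simpa [clarkeGradient] using h
  obtain ⟨c, hc1, hc2⟩ := exists_between hv
  have h2 : ∀ᶠ ξ' in 𝓝 ξ, c < ⟪ξ', v⟫_ℝ :=
    (Continuous.tendsto (f := fun ξ' : E => ⟪ξ', v⟫_ℝ) (by fun_prop) ξ).eventually
      (lt_mem_nhds hc2)
  filter_upwards [(eventually_clarkeDeriv_le hf hc1).prod_nhds h2] with p hp hmem
  exact absurd (hmem v) (not_le.2 (hp.1.trans_lt hp.2))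

theorem convex_clarkeGradient (f : E → ℝ) (x : E) : Convex ℝ (clarkeGradient f x) := by
  intro ξ hξ ζ hζ a b ha hb hab v
  rw [inner_add_left, inner_smul_left, inner_smul_left]
  calc a * ⟪ξ, v⟫_ℝ + b * ⟪ζ, v⟫_ℝ ≤ a * clarkeDeriv f x v + b * clarkeDeriv f x v := by
        gcongr
        · exact hξ v
        · exact hζ v
    _ = clarkeDeriv f x v := by rw [← add_mul, hab, one_mul]

theorem nonempty_clarkeGradient [FiniteDimensional ℝ E] (hf : LocallyLipschitz f) (x : E) :
    (clarkeGradient f x).Nonempty := by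
  -- Hahn–Banach: `f°(x; ·)` is sublinear, so the zero functional on the trivial subspace extends to
  -- a linear functional below it.
  obtain ⟨g, -, hg⟩ := exists_extension_of_le_sublinear (⊥ : E →ₗ.[ℝ] ℝ) (clarkeDeriv f x)
    (fun c hc v => clarkeDeriv_smul hf hc x v) (clarkeDeriv_add_le hf x) (by
      rintro ⟨y, hy⟩
      obtain rfl : y = 0 := (Submodule.mem_bot ℝ).1 hy
      rw [clarkeDeriv_zero hf]
      exact (LinearPMap.map_zero _).le)
  have : CompleteSpace E := FiniteDimensional.complete ℝ E
  refine ⟨(InnerProductSpace.toDual ℝ E).symm (LinearMap.toContinuousLinearMap g), fun v => ?_⟩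
  rw [InnerProductSpace.toDual_symm_apply]
  exact hg v

/-- Strict differentiability is essential here: the base point moves together with the step. -/
theorem tendsto_strict_remainder {G : Type*} [NormedAddCommGroup G] [NormedSpace ℝ G] {ψ : E → G}
    {B : E →L[ℝ] G} (hψ : HasStrictFDerivAt ψ B x) (v : E) :
    Tendsto (fun p : E × ℝ => ‖ψ (p.1 + p.2 • v) - ψ p.1 - p.2 • B v‖ / p.2)
      (𝓝 x ×ˢ 𝓝[>] (0 : ℝ)) (𝓝 0) := by
  have hpair : Tendsto (fun p : E × ℝ => (p.1 + p.2 • v, p.1)) (𝓝 x ×ˢ 𝓝[>] (0 : ℝ))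
      (𝓝 (x, x)) := by
    rw [nhds_prod_eq]
    exact (tendsto_add_smul_nhds x v).prodMk tendsto_fst
  have h1 := (hψ.isLittleO.comp_tendsto hpair)
  have h2 : (fun p : E × ℝ => p.1 + p.2 • v - p.1) =O[𝓝 x ×ˢ 𝓝[>] (0 : ℝ)] fun p => p.2 := by
    refine Asymptotics.IsBigO.of_bound ‖v‖ (Eventually.of_forall fun p => ?_)
    rw [add_sub_cancel_left, norm_smul, mul_comm]
  have h3 := (h1.trans_isBigO h2).norm_left.tendsto_div_nhds_zero
  refine h3.congr fun p => ?_
  simp [map_smul]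

/-- The chain rule for generalized directional derivatives, with a smooth summand and an inner
submersion. -/
theorem clarkeDeriv_add_comp [CompleteSpace E] {E' : Type*} [NormedAddCommGroup E']
    [InnerProductSpace ℝ E'] [CompleteSpace E'] {U : E' → ℝ} (hU : LocallyLipschitz U)
    {g : E → ℝ} {g' : E →L[ℝ] ℝ} (hg : HasStrictFDerivAt g g' x)
    {Φ : E → E'} {A : E →L[ℝ] E'} (hΦ : HasStrictFDerivAt Φ A x)
    (hA : Function.Surjective A) (v : E) :
    clarkeDeriv (fun y => g y + U (Φ y)) x v = g' v + clarkeDeriv U (Φ x) (A v) := by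
  set l : Filter (E × ℝ) := 𝓝 x ×ˢ 𝓝[>] (0 : ℝ) with hl
  -- A strict derivative that is onto makes `Φ` open at `x`, so the points `Φ y` fill a whole
  -- neighbourhood of `Φ x`. Hence the chain rule is an equality, not just an upper bound.
  have hmap : map (Prod.map Φ id) l = 𝓝 (Φ x) ×ˢ 𝓝[>] (0 : ℝ) := by
    rw [hl, ← prod_map_map_eq', hΦ.map_nhds_eq_of_surj (LinearMap.range_eq_top.2 hA), map_id]
  have hgq := tendsto_strict_remainder hg v
  have hΦq := tendsto_strict_remainder hΦ v
  have key : clarkeDeriv U (Φ x) (A v)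
      = limsup (fun p : E × ℝ => (U (Φ p.1 + p.2 • A v) - U (Φ p.1)) / p.2) l := by
    rw [clarkeDeriv, ← hmap]
    rfl
  obtain ⟨K, hK0, hK⟩ := eventually_abs_quotient_le hU (Φ x)
  have hbd : ∀ᶠ p : E × ℝ in l, |(U (Φ p.1 + p.2 • A v) - U (Φ p.1)) / p.2| ≤ K * ‖A v‖ := by
    have := hK.self_of_nhds (A v)
    rw [← hmap] at this
    exact this
  rw [key, add_comm]
  refine limsup_eq_limsup_add_of_tendsto_sub hbd ?_
  obtain ⟨L, s, hs, hL⟩ := hU (Φ x)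
  have hΦc : Tendsto Φ (𝓝 x) (𝓝 (Φ x)) := hΦ.hasFDerivAt.continuousAt
  have hmem1 : ∀ᶠ p : E × ℝ in l, Φ (p.1 + p.2 • v) ∈ s :=
    (hΦc.comp (tendsto_add_smul_nhds x v)) hs
  have hmem2 : ∀ᶠ p : E × ℝ in l, Φ p.1 + p.2 • A v ∈ s := by
    have h := tendsto_add_smul_nhds (Φ x) (A v)
    rw [← hmap] at h
    exact h hs
  rw [tendsto_iff_norm_sub_tendsto_zero]
  have hsum := hgq.add (hΦq.const_mul (L : ℝ))
  rw [mul_zero, add_zero] at hsum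
  refine squeeze_zero' (Eventually.of_forall fun p => norm_nonneg _) ?_ hsum
  filter_upwards [hmem1, hmem2, eventually_snd_pos x] with p h1 h2 h3
  have h4 := hL.dist_le_mul _ h1 _ h2
  rw [Real.dist_eq, dist_eq_norm, ← sub_sub] at h4
  have h5 : (g (p.1 + p.2 • v) + U (Φ (p.1 + p.2 • v)) - (g p.1 + U (Φ p.1))) / p.2
      - (U (Φ p.1 + p.2 • A v) - U (Φ p.1)) / p.2 - g' v
      = ((g (p.1 + p.2 • v) - g p.1 - p.2 • g' v)
        + (U (Φ (p.1 + p.2 • v)) - U (Φ p.1 + p.2 • A v))) / p.2 := by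
    rw [smul_eq_mul]
    field_simp
    ring
  rw [h5, norm_div, Real.norm_of_nonneg h3.le, ← mul_div_assoc, ← add_div]
  gcongr
  exact (norm_add_le _ _).trans (by gcongr; exact h4)

/-- Along a differentiable curve through a point of regularity, the derivative of the function is
dominated by every generalized gradient. -/
theorem deriv_le_inner_of_clarkeRegularAt (hf : LocallyLipschitz f) {γ : ℝ → E} {γ' : E}
    {t V' : ℝ} (hreg : ClarkeRegularAt f (γ t)) (hγ : HasDerivAt γ γ' t)
    (hV : HasDerivAt (fun s => f (γ s)) V' t) {ξ : E} (hξ : ξ ∈ clarkeGradient f (γ t)) :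
    V' ≤ ⟪ξ, γ'⟫_ℝ := by
  have hneg : Tendsto (fun h : ℝ => -h) (𝓝[>] 0) (𝓝 0) := by
    have : Tendsto (fun h : ℝ => -h) (𝓝 0) (𝓝 (-0)) := continuous_neg.tendsto 0
    rw [neg_zero] at this
    exact this.mono_left nhdsWithin_le_nhds
  have hadd : Tendsto (fun h : ℝ => t + -h) (𝓝[>] 0) (𝓝 t) := by
    simpa using hneg.const_add t
  -- The curve is followed backwards: regularity in the direction `-γ'` gives `-V' = f°(γ t; -γ')`,
  -- which dominates `⟪ξ, -γ'⟫`.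
  have h1 : Tendsto (fun h : ℝ => (f (γ (t + -h)) - f (γ t)) / h) (𝓝[>] 0) (𝓝 (-V')) := by
    have h := (hasDerivAt_iff_tendsto_slope_zero.1 hV).comp
      (tendsto_nhdsWithin_iff.2 ⟨hneg, by
        filter_upwards [self_mem_nhdsWithin] with h hh
        simpa using (ne_of_gt hh)⟩)
    refine h.neg.congr' ?_
    filter_upwards [self_mem_nhdsWithin] with h hh
    have hh : 0 < h := hh
    simp only [Function.comp, smul_eq_mul]
    field_simp
  have h2 := hreg (-γ')
  obtain ⟨L, s, hs, hL⟩ := hf (γ t)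
  have h3 : Tendsto (fun h : ℝ => ‖γ (t + -h) - γ t - (-h) • γ'‖ / h) (𝓝[>] 0) (𝓝 0) := by
    have h := ((hasDerivAt_iff_isLittleO.1 hγ).comp_tendsto hadd).norm_left
    have h' : (fun h : ℝ => t + -h - t) =O[𝓝[>] 0] fun h => h :=
      Asymptotics.IsBigO.of_bound 1 (Eventually.of_forall fun h => by simp)
    refine ((h.trans_isBigO h').tendsto_div_nhds_zero).congr fun p => ?_
    simp
  have h4 : Tendsto (fun h : ℝ => (f (γ (t + -h)) - f (γ t)) / h
      - (f (γ t + h • (-γ')) - f (γ t)) / h) (𝓝[>] 0) (𝓝 0) := by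
    have hsum := h3.const_mul (L : ℝ)
    rw [mul_zero] at hsum
    refine squeeze_zero_norm' ?_ hsum
    have hm1 : ∀ᶠ h : ℝ in 𝓝[>] 0, γ (t + -h) ∈ s :=
      (hγ.continuousAt.tendsto.comp hadd) hs
    have hm2 : ∀ᶠ h : ℝ in 𝓝[>] 0, γ t + h • (-γ') ∈ s := by
      have : Tendsto (fun h : ℝ => γ t + h • (-γ')) (𝓝 0) (𝓝 (γ t + (0 : ℝ) • (-γ'))) :=
        Continuous.tendsto (by fun_prop) _
      rw [zero_smul, add_zero] at this
      exact (this.mono_left nhdsWithin_le_nhds) hs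
    filter_upwards [hm1, hm2, self_mem_nhdsWithin] with h g1 g2 g3
    have g3 : 0 < h := g3
    have := hL.dist_le_mul _ g1 _ g2
    rw [Real.dist_eq, dist_eq_norm, ← sub_sub, smul_neg, ← neg_smul] at this
    rw [← sub_div, norm_div, Real.norm_of_nonneg g3.le, ← mul_div_assoc, sub_sub_sub_cancel_right,
      smul_neg, ← neg_smul]
    gcongr
    exact this
  have h5 : -V' - clarkeDeriv f (γ t) (-γ') = 0 := tendsto_nhds_unique (h1.sub h2) h4
  have h6 := hξ (-γ')
  rw [inner_neg_right] at h6
  linarith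

end Clarke

/-! ### Absolutely continuous curves -/

theorem _root_.AbsolutelyContinuousOnInterval.comp_locallyLipschitzOn {X Y : Type*}
    [NormedAddCommGroup X] [PseudoMetricSpace Y] {g : X → Y} {s : Set X}
    (hg : LocallyLipschitzOn s g) {x : ℝ → X} {a b : ℝ}
    (hx : AbsolutelyContinuousOnInterval x a b) (hs : MapsTo x (uIcc a b) s) :
    AbsolutelyContinuousOnInterval (fun t => g (x t)) a b := by
  have hcomp : IsCompact (x '' uIcc a b) := isCompact_uIcc.image_of_continuousOn hx.continuousOn
  obtain ⟨K, hK⟩ := (hg.mono hs.image_subset).exists_lipschitzOnWith_of_compact hcomp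
  have h := Tendsto.const_mul (K : ℝ) hx
  rw [mul_zero] at h
  refine squeeze_zero' (Eventually.of_forall fun E => Finset.sum_nonneg fun _ _ => dist_nonneg)
    ?_ h
  filter_upwards [mem_inf_of_right (mem_principal_self _)] with E hE
  rw [Finset.mul_sum]
  refine Finset.sum_le_sum fun i hi => hK.dist_le_mul _ ?_ _ ?_
  · exact mem_image_of_mem _ (hE.1 i hi).1
  · exact mem_image_of_mem _ (hE.1 i hi).2

theorem _root_.AbsolutelyContinuousOnInterval.comp_locallyLipschitz {X Y : Type*}
    [NormedAddCommGroup X] [PseudoMetricSpace Y] {g : X → Y} (hg : LocallyLipschitz g)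
    {x : ℝ → X} {a b : ℝ} (hx : AbsolutelyContinuousOnInterval x a b) :
    AbsolutelyContinuousOnInterval (fun t => g (x t)) a b :=
  hx.comp_locallyLipschitzOn (hg.locallyLipschitzOn (s := univ)) (mapsTo_univ _ _)

theorem _root_.AbsolutelyContinuousOnInterval.sub_le_integral {f w : ℝ → ℝ} {a b : ℝ} (hab : a ≤ b)
    (hf : AbsolutelyContinuousOnInterval f a b) (hw : IntervalIntegrable w volume a b)
    (h : ∀ᵐ t : ℝ, t ∈ Ioo a b → DifferentiableAt ℝ f t → deriv f t ≤ w t) :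
    f b - f a ≤ ∫ t in a..b, w t := by
  rw [← hf.integral_deriv_eq_sub]
  refine intervalIntegral.integral_mono_ae_restrict hab hf.intervalIntegrable_deriv hw ?_
  rw [EventuallyLE, ← restrict_Ioo_eq_restrict_Icc, ae_restrict_iff' measurableSet_Ioo]
  filter_upwards [h, hf.ae_differentiableAt] with t h1 h2 ht
  exact h1 ht (h2 (uIcc_of_le hab ▸ Ioo_subset_Icc_self ht))

/-- Testing against continuous functionals reduces the bound to the scalar inequality. -/
theorem _root_.AbsolutelyContinuousOnInterval.norm_sub_le {X : Type*} [NormedAddCommGroup X]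
    [NormedSpace ℝ X] {x : ℝ → X} {a b C : ℝ} (hab : a ≤ b) (hC : 0 ≤ C)
    (hx : AbsolutelyContinuousOnInterval x a b)
    (h : ∀ᵐ t : ℝ, t ∈ Ioo a b → ∃ x', HasDerivAt x x' t ∧ ‖x'‖ ≤ C) :
    ‖x b - x a‖ ≤ C * (b - a) := by
  refine NormedSpace.norm_le_dual_bound ℝ _ (mul_nonneg hC (sub_nonneg.2 hab)) fun p => ?_
  have key : ∀ p : StrongDual ℝ X, p (x b - x a) ≤ C * (b - a) * ‖p‖ := by
    intro p
    have hpx : AbsolutelyContinuousOnInterval (fun t => p (x t)) a b :=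
      hx.comp_locallyLipschitz p.lipschitz.locallyLipschitz
    have := hpx.sub_le_integral hab (w := fun _ => C * ‖p‖) intervalIntegrable_const (by
      filter_upwards [h] with t ht hmem _
      obtain ⟨x', h1, h2⟩ := ht hmem
      have h3 : HasDerivAt (fun t => p (x t)) (p x') t := p.hasFDerivAt.comp_hasDerivAt t h1
      rw [h3.deriv]
      calc p x' ≤ ‖p x'‖ := le_abs_self _
        _ ≤ ‖p‖ * ‖x'‖ := p.le_opNorm _
        _ ≤ C * ‖p‖ := by rw [mul_comm C]; gcongr)
    rw [intervalIntegral.integral_const, smul_eq_mul] at this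
    rw [map_sub]
    linarith
  rw [Real.norm_eq_abs, abs_le]
  have h1 := key p
  have h2 := key (-p)
  rw [norm_neg, neg_apply] at h2
  exact ⟨by linarith, h1⟩

/-- Almost everywhere on its zero set, a curve has no nonzero derivative. -/
theorem ae_eq_zero_of_hasDerivAt {X : Type*} [NormedAddCommGroup X] [NormedSpace ℝ X] (f : ℝ → X) :
    ∀ᵐ t : ℝ, f t = 0 → ∀ f', HasDerivAt f f' t → f' = 0 := by
  set Z : Set ℝ := {t | f t = 0 ∧ ∃ f', HasDerivAt f f' t ∧ f' ≠ 0}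
  -- A zero with nonzero derivative is isolated among the zeros, so `Z` is a discrete subset of the
  -- line, hence countable and null.
  have hZ : Z.Countable := by
    refine (HereditarilyLindelofSpace.isLindelof Z).countable_of_isDiscrete ?_
    rw [isDiscrete_iff_nhdsNE]
    rintro t ⟨-, f', hf', h0⟩
    rw [inf_principal_eq_bot]
    filter_upwards [hf'.eventually_ne h0 (c := 0)] with s hs hsZ
    exact hs hsZ.1
  filter_upwards [compl_mem_ae_iff.2 (hZ.measure_zero volume)] with t ht h0 f' hf'
  by_contra hne
  exact ht ⟨h0, f', hf', hne⟩

theorem exists_first_hitting {u : ℝ → ℝ} {a b r : ℝ} (hab : a ≤ b) (hu : ContinuousOn u (Icc a b))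
    (ha : u a < r) (hb : r ≤ u b) :
    ∃ c ∈ Icc a b, u c = r ∧ ∀ s ∈ Icc a c, u s ≤ r := by
  have hcomp : IsCompact (Icc a b ∩ u ⁻¹' Ici r) :=
    isCompact_Icc.of_isClosed_subset (hu.preimage_isClosed_of_isClosed isClosed_Icc isClosed_Ici)
      inter_subset_left
  obtain ⟨c, ⟨hc, hcr⟩, hmin⟩ := hcomp.exists_isLeast ⟨b, right_mem_Icc.2 hab, hb⟩
  have hlt : ∀ s ∈ Icc a c, s ≠ c → u s < r := fun s hs hne => by
    by_contra hcon
    exact hne (le_antisymm hs.2 (hmin ⟨⟨hs.1, hs.2.trans hc.2⟩, not_lt.1 hcon⟩))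
  obtain ⟨s, hs, hsr⟩ := intermediate_value_Icc hc.1 (hu.mono (Icc_subset_Icc_right hc.2))
    ⟨ha.le, hcr⟩
  have hsc : s = c := by
    by_contra hne
    exact (hlt s hs hne).ne hsr
  subst hsc
  refine ⟨s, hc, hsr, fun z hz => ?_⟩
  rcases eq_or_ne z s with rfl | hne
  · exact hsr.le
  · exact (hlt z hz hne).le

section Inclusion

variable {X : Type*} [NormedAddCommGroup X] [NormedSpace ℝ X] {F : ℝ → X → Set X} {x : ℝ → X}

theorem IsSolutionOn.mono {I J : Set ℝ} (h : IsSolutionOn F I x) (hJ : J ⊆ I) :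
    IsSolutionOn F J x :=
  ⟨fun a ha b hb => h.1 a (hJ ha) b (hJ hb), h.2.mono fun _ ht hm => ht (hJ hm)⟩

theorem IsSolutionOn.continuousOn {t₀ τ s t : ℝ} (h : IsSolutionOn F (Ico t₀ τ) x)
    (hs : s ∈ Ico t₀ τ) (ht : t ∈ Ico t₀ τ) : ContinuousOn x (Icc s t) := by
  rcases le_or_gt s t with hst | hst
  · simpa [uIcc_of_le hst] using (h.1 s hs t ht hst).continuousOn
  · simp [Icc_eq_empty (not_le.2 hst)]

/-! ### Existence of solutions -/

/-- The explicit Euler scheme for the field `f` with step `h`. -/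
def eulerSeq (f : ℝ → X → X) (t₀ : ℝ) (x₀ : X) (h : ℝ) : ℕ → X
  | 0 => x₀
  | k + 1 => eulerSeq f t₀ x₀ h k + h • f (t₀ + k * h) (eulerSeq f t₀ x₀ h k)

theorem eulerSeq_sub (f : ℝ → X → X) (t₀ : ℝ) (x₀ : X) (h : ℝ) {i j : ℕ} (hij : i ≤ j) :
    eulerSeq f t₀ x₀ h j - eulerSeq f t₀ x₀ h i
      = ∑ k ∈ Finset.Ico i j, h • f (t₀ + k * h) (eulerSeq f t₀ x₀ h k) := by
  rw [← Finset.sum_Ico_sub _ hij]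
  refine Finset.sum_congr rfl fun k _ => ?_
  rw [eulerSeq, add_sub_cancel_left]

theorem norm_eulerSeq_sub_le {f : ℝ → X → X} {C : ℝ} (hf : ∀ t x, ‖f t x‖ ≤ C) (t₀ : ℝ) (x₀ : X)
    {h : ℝ} (hh : 0 ≤ h) {i j : ℕ} (hij : i ≤ j) :
    ‖eulerSeq f t₀ x₀ h j - eulerSeq f t₀ x₀ h i‖ ≤ C * (h * j - h * i) := by
  rw [eulerSeq_sub f t₀ x₀ h hij]
  refine (norm_sum_le_of_le (n := fun _ => h * C) _ fun k _ => ?_).trans ?_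
  · rw [norm_smul, Real.norm_of_nonneg hh]
    gcongr
    exact hf _ _
  · rw [Finset.sum_const, Nat.card_Ico, nsmul_eq_mul, Nat.cast_sub hij]
    apply le_of_eq
    ring

/-- The natural floor of a negative number is `0`, so the Euler curve is frozen before the initial
time; `max u 0` records this. -/
theorem mul_floor_div_mem {h u : ℝ} (hh : 0 < h) :
    max u 0 - h ≤ h * ⌊u / h⌋₊ ∧ h * ⌊u / h⌋₊ ≤ max u 0 := by
  rcases le_or_gt u 0 with hu | hu
  · rw [Nat.floor_of_nonpos (div_nonpos_of_nonpos_of_nonneg hu hh.le), max_eq_right hu]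
    simp [hh.le]
  · rw [max_eq_left hu.le]
    have h1 := Nat.floor_le (div_nonneg hu.le hh.le)
    have h2 := Nat.lt_floor_add_one (u / h)
    rw [le_div_iff₀ hh] at h1
    rw [div_lt_iff₀ hh] at h2
    constructor <;> nlinarith

/-- A bounded set-valued field with closed graph is upper semicontinuous. -/
theorem exists_subset_cthickening_of_isClosed_graph {X : Type*} [NormedAddCommGroup X]
    [ProperSpace X] {F : ℝ → X → Set X} {C : ℝ}
    (hbdd : ∀ t x, ∀ y ∈ F t x, ‖y‖ ≤ C)
    (hclosed : IsClosed {p : (ℝ × X) × X | p.2 ∈ F p.1.1 p.1.2}) (hne : ∀ t x, (F t x).Nonempty)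
    (t : ℝ) (x : X) {ε : ℝ} (hε : 0 < ε) :
    ∀ᶠ p : ℝ × X in 𝓝 (t, x), F p.1 p.2 ⊆ Metric.cthickening ε (F t x) := by
  set B : Set X := Metric.closedBall 0 C
  have : CompactSpace B := isCompact_iff_compactSpace.1 (isCompact_closedBall 0 C)
  -- The bad pairs: values of the field at distance at least `ε` from `F t x`. Their projection
  -- along the compact factor `B` is closed and misses `(t, x)`.
  set S : Set ((ℝ × X) × B) :=
    {p | (p.2 : X) ∈ F p.1.1 p.1.2 ∧ ε ≤ Metric.infDist (p.2 : X) (F t x)}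
  have hS : IsClosed S := by
    refine IsClosed.inter ?_ ?_
    · exact hclosed.preimage (f := fun p : (ℝ × X) × B => (p.1, (p.2 : X))) (by fun_prop)
    · exact isClosed_le continuous_const
        ((Metric.continuous_infDist_pt _).comp (by fun_prop))
  have hproj := (isClosedMap_fst_of_compactSpace (X := ℝ × X) (Y := B)) S hS
  have hnot : (t, x) ∉ Prod.fst '' S := by
    rintro ⟨⟨q, z⟩, ⟨h1, h2⟩, rfl⟩
    rw [Metric.infDist_zero_of_mem h1] at h2
    linarith
  filter_upwards [hproj.isOpen_compl.mem_nhds hnot] with p hp z hz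
  refine Metric.thickening_subset_cthickening _ _
    ((Metric.mem_thickening_iff_infDist_lt (hne t x)).2 (not_le.1 fun hcon => hp ?_))
  exact ⟨(p, ⟨z, mem_closedBall_zero_iff.2 (hbdd _ _ z hz)⟩), ⟨hz, hcon⟩, rfl⟩

/-- Existence of solutions of a differential inclusion whose right-hand side is bounded, with
nonempty convex values and closed graph. -/
theorem exists_lipschitz_solution [FiniteDimensional ℝ X] {C : NNReal}
    (hbdd : ∀ t x, ∀ y ∈ F t x, ‖y‖ ≤ C)
    (hclosed : IsClosed {p : (ℝ × X) × X | p.2 ∈ F p.1.1 p.1.2}) (hne : ∀ t x, (F t x).Nonempty)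
    (hconv : ∀ t x, Convex ℝ (F t x)) (t₀ : ℝ) (x₀ : X) :
    ∃ x : ℝ → X, x t₀ = x₀ ∧ LipschitzWith C x ∧
      ∀ᵐ t : ℝ, t₀ ≤ t → ∃ x', HasDerivAt x x' t ∧ x' ∈ F t (x t) := by
  have : ProperSpace X := FiniteDimensional.proper_real X
  choose f hf using hne
  have hfC : ∀ t x, ‖f t x‖ ≤ C := fun t x => hbdd t x _ (hf t x)
  set h : ℕ → ℝ := fun n => 1 / ((n : ℝ) + 1)
  have hpos : ∀ n, 0 < h n := fun n => Nat.one_div_pos_of_nat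
  set k : ℝ → ℕ → ℕ := fun t n => ⌊(t - t₀) / h n⌋₊
  set y : ℕ → ℕ → X := fun n => eulerSeq f t₀ x₀ (h n)
  -- Along an ultrafilter every bounded sequence in a proper space converges, so the Euler curves
  -- converge at all times simultaneously and no Arzelà–Ascoli subsequence is needed.
  set l : Filter ℕ := (hyperfilter ℕ : Filter ℕ)
  have hh : Tendsto h l (𝓝 0) :=
    tendsto_one_div_add_atTop_nhds_zero_nat.mono_left Nat.hyperfilter_le_atTop
  have hk : ∀ t n, max (t - t₀) 0 - h n ≤ h n * k t n ∧ h n * k t n ≤ max (t - t₀) 0 :=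
    fun t n => mul_floor_div_mem (hpos n)
  have hkmono : ∀ n {s t : ℝ}, s ≤ t → k s n ≤ k t n := fun n s t hst =>
    Nat.floor_mono (by have := hpos n; gcongr)
  have hincr : ∀ n {s t : ℝ}, s ≤ t → h n * k t n - h n * k s n ≤ t - s + h n := by
    intro n s t hst
    have h1 := (hk t n).2
    have h2 := (hk s n).1
    have h3 : max (t - t₀) 0 ≤ max (s - t₀) 0 + (t - s) :=
      max_le (by linarith [le_max_left (s - t₀) 0]) (by linarith [le_max_right (s - t₀) 0])
    linarith
  have hlip : ∀ n {s t : ℝ}, s ≤ t → ‖y n (k t n) - y n (k s n)‖ ≤ C * (t - s + h n) :=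
    fun n s t hst => (norm_eulerSeq_sub_le hfC t₀ x₀ (hpos n).le (hkmono n hst)).trans
      (mul_le_mul_of_nonneg_left (hincr n hst) C.2)
  have hlim : ∀ t, ∃ z, Tendsto (fun n => y n (k t n)) l (𝓝 z) := by
    intro t
    have hmem : ∀ n, y n (k t n) ∈ Metric.closedBall x₀ (C * max (t - t₀) 0) := by
      intro n
      rw [mem_closedBall_iff_norm]
      have h1 := norm_eulerSeq_sub_le hfC t₀ x₀ (hpos n).le (Nat.zero_le (k t n))
      rw [Nat.cast_zero, mul_zero, sub_zero] at h1
      exact h1.trans (mul_le_mul_of_nonneg_left (hk t n).2 C.2)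
    obtain ⟨z, -, hz⟩ := (isCompact_closedBall x₀ (C * max (t - t₀) 0)).ultrafilter_le_nhds
      ((hyperfilter ℕ).map fun n => y n (k t n))
      (le_principal_iff.2 (Ultrafilter.mem_map.2 (univ_mem' hmem)))
    exact ⟨z, hz⟩
  choose x hx using hlim
  have hxlip : ∀ {s t : ℝ}, s ≤ t → ‖x t - x s‖ ≤ C * (t - s) := by
    intro s t hst
    have h1 := ((hx t).sub (hx s)).norm
    have h2 : Tendsto (fun n => C * (t - s + h n)) l (𝓝 (C * (t - s + 0))) :=
      (hh.const_add _).const_mul _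
    rw [add_zero] at h2
    exact le_of_tendsto_of_tendsto' h1 h2 fun n => hlip n hst
  have hxL : LipschitzWith C x := by
    refine LipschitzWith.of_dist_le_mul fun s t => ?_
    rw [dist_eq_norm, Real.dist_eq]
    rcases le_total s t with hst | hst
    · rw [norm_sub_rev, abs_sub_comm, abs_of_nonneg (sub_nonneg.2 hst)]
      exact hxlip hst
    · rw [abs_of_nonneg (sub_nonneg.2 hst)]
      exact hxlip hst
  refine ⟨x, ?_, hxL, ?_⟩
  · refine tendsto_nhds_unique (hx t₀) (tendsto_const_nhds.congr fun n => ?_)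
    simp [y, k, eulerSeq]
  filter_upwards [hxL.ae_differentiableAt_real] with t hdiff ht
  refine ⟨deriv x t, hdiff.hasDerivAt, ?_⟩
  have hAclosed : IsClosed (F t (x t)) :=
    hclosed.preimage (f := fun z : X => ((t, x t), z)) (by fun_prop)
  -- A closed set is the intersection of its closed thickenings, so it suffices to place the
  -- derivative in each convex closed `B`.
  rw [← hAclosed.closure_eq, Metric.closure_eq_iInter_cthickening, mem_iInter₂]
  intro ε hε
  set B := Metric.cthickening ε (F t (x t))
  have hBclosed : IsClosed B := Metric.isClosed_cthickening
  have hBconv : Convex ℝ B := (hconv t (x t)).cthickening ε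
  obtain ⟨δ, hδ, hδB⟩ := Metric.eventually_nhds_iff.1
    (exists_subset_cthickening_of_isClosed_graph hbdd hclosed (fun t x => ⟨_, hf t x⟩) t (x t) hε)
  have hslope : ∀ᶠ r : ℝ in 𝓝[>] 0, r⁻¹ • (x (t + r) - x t) ∈ B := by
    have hsmall : ∀ᶠ r : ℝ in 𝓝[>] 0, r < δ ∧ C * r < δ := by
      have h1 : Tendsto (fun r : ℝ => C * r) (𝓝 0) (𝓝 0) := by
        simpa using (continuous_const_mul (C : ℝ)).tendsto 0
      exact nhdsWithin_le_nhds ((gt_mem_nhds hδ).and (h1.eventually (gt_mem_nhds hδ)))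
    filter_upwards [hsmall, self_mem_nhdsWithin] with r ⟨hr1, hr2⟩ hr0
    have hr0 : 0 < r := hr0
    have htr : t ≤ t + r := by linarith
    have hlen : Tendsto (fun n => h n * k (t + r) n - h n * k t n) l (𝓝 r) := by
      have hup : Tendsto (fun n => r + h n) l (𝓝 r) := by simpa using hh.const_add r
      have hlo : Tendsto (fun n => r - h n) l (𝓝 r) := by simpa using hh.const_sub r
      refine tendsto_of_tendsto_of_tendsto_of_le_of_le hlo hup (fun n => ?_) fun n => ?_
      · have h1 := (hk (t + r) n).1
        have h2 := (hk t n).2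
        rw [max_eq_left (by linarith)] at h1 h2
        dsimp only
        linarith
      · have := hincr n htr
        dsimp only
        linarith
    have hconvg : Tendsto (fun n => (h n * k (t + r) n - h n * k t n)⁻¹ •
        (y n (k (t + r) n) - y n (k t n))) l (𝓝 (r⁻¹ • (x (t + r) - x t))) :=
      (hlen.inv₀ hr0.ne').smul ((hx _).sub (hx t))
    refine hBclosed.mem_of_tendsto hconvg ?_
    have hnear : ∀ᶠ n in l, C * (r + h n) + dist (y n (k t n)) (x t) < δ := by
      have h1 : Tendsto (fun n => C * (r + h n) + dist (y n (k t n)) (x t)) l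
          (𝓝 (C * (r + 0) + dist (x t) (x t))) :=
        ((hh.const_add r).const_mul _).add ((hx t).dist tendsto_const_nhds)
      rw [add_zero, dist_self, add_zero] at h1
      exact h1.eventually (gt_mem_nhds hr2)
    filter_upwards [hlen.eventually (lt_mem_nhds hr0), hnear, hh.eventually (gt_mem_nhds hδ)]
      with n hn1 hn2 hn3
    have hij := hkmono n htr
    have hmem : ∀ i ∈ Finset.Ico (k t n) (k (t + r) n), f (t₀ + i * h n) (y n i) ∈ B := by
      intro i hi
      obtain ⟨hi1, hi2⟩ := Finset.mem_Ico.1 hi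
      have hi1' : h n * k t n ≤ h n * i := by have := hpos n; gcongr
      have hi2' : h n * i ≤ h n * k (t + r) n := by have := hpos n; gcongr
      refine hδB (y := (t₀ + i * h n, y n i)) ?_ (hf _ _)
      rw [Prod.dist_eq, max_lt_iff]
      constructor
      · have h1 := (hk t n).1
        have h2 := (hk (t + r) n).2
        rw [max_eq_left (by linarith)] at h1 h2
        rw [Real.dist_eq, abs_lt]
        constructor <;> linarith
      · have h1 : ‖y n i - y n (k t n)‖ ≤ C * (h n * i - h n * k t n) :=
          norm_eulerSeq_sub_le hfC t₀ x₀ (hpos n).le hi1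
        have h2 := hincr n htr
        have h3 : C * (h n * i - h n * k t n) ≤ C * (r + h n) :=
          mul_le_mul_of_nonneg_left (by linarith) C.2
        calc dist (y n i) (x t) ≤ dist (y n i) (y n (k t n)) + dist (y n (k t n)) (x t) :=
              dist_triangle _ _ _
          _ < δ := by rw [dist_eq_norm]; linarith
    -- A difference quotient of the Euler curve is a centre of mass of field values taken near `(t,
    -- x t)`, so convexity keeps it in `B`.
    have hw : h n * k (t + r) n - h n * k t n
        = ∑ _i ∈ Finset.Ico (k t n) (k (t + r) n), h n := by
      rw [Finset.sum_const, Nat.card_Ico, nsmul_eq_mul, Nat.cast_sub hij]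
      ring
    have := hBconv.centerMass_mem (t := Finset.Ico (k t n) (k (t + r) n)) (w := fun _ => h n)
      (fun _ _ => (hpos n).le) (hw ▸ hn1) hmem
    rw [Finset.centerMass, ← hw, ← eulerSeq_sub f t₀ x₀ (h n) hij] at this
    exact this
  have hd := hasDerivAt_iff_tendsto_slope_zero.1 hdiff.hasDerivAt
  have hd' : Tendsto (fun r : ℝ => r⁻¹ • (x (t + r) - x t)) (𝓝[>] 0) (𝓝 (deriv x t)) :=
    hd.mono_left (nhdsWithin_mono _ fun r hr => ne_of_gt hr)
  exact hBclosed.mem_of_tendsto hd' hslope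

end Inclusion

/-! ### Asymptotic stability from a strict Lyapunov function -/

section Lyapunov

variable {X : Type*} [NormedAddCommGroup X] [NormedSpace ℝ X]

/-- The radial retraction onto the closed ball of radius `R`. -/
def ballRetract (R : ℝ) (x : X) : X := (R / max R ‖x‖) • x

theorem continuous_ballRetract {R : ℝ} (hR : 0 < R) : Continuous (ballRetract R : X → X) := by
  refine Continuous.smul (continuous_const.div (by fun_prop) fun x => ?_) continuous_id
  exact (hR.trans_le (le_max_left _ _)).ne'

theorem norm_ballRetract_le {R : ℝ} (hR : 0 < R) (x : X) : ‖ballRetract R x‖ ≤ R := by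
  have hm : 0 < max R ‖x‖ := hR.trans_le (le_max_left _ _)
  rw [ballRetract, norm_smul, Real.norm_of_nonneg (by positivity), div_mul_eq_mul_div,
    div_le_iff₀ hm]
  gcongr
  exact le_max_right _ _

theorem ballRetract_eq_self {R : ℝ} (hR : 0 < R) {x : X} (hx : ‖x‖ ≤ R) : ballRetract R x = x := by
  rw [ballRetract, max_eq_left hx, div_self hR.ne', one_smul]

/-- On the closed ball of radius `R`, the functions `H` and `W` are continuous and positive
definite, and `Ḣ ≤ -W` along the solutions of `ẋ ∈ F(t, x)`. -/
structure IsStrictLyapunovOn (F : ℝ → X → Set X) (H W : X → ℝ) (R : ℝ) : Prop where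
  radius_pos : 0 < R
  continuousOn_H : ContinuousOn H (Metric.closedBall 0 R)
  continuousOn_W : ContinuousOn W (Metric.closedBall 0 R)
  H_zero : H 0 = 0
  W_zero : W 0 = 0
  pos : ∀ x, ‖x‖ ≤ R → x ≠ 0 → 0 < H x ∧ 0 < W x
  decrease : ∀ (t₀ τ : ℝ) (x : ℝ → X), IsSolutionOn F (Ico t₀ τ) x →
    ∀ s ∈ Ico t₀ τ, ∀ t ∈ Ico t₀ τ, s ≤ t → (∀ z ∈ Icc s t, ‖x z‖ ≤ R) →
      H (x t) - H (x s) ≤ -∫ z in s..t, W (x z)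

/-- On the closed ball of radius `R`, the right-hand side has nonempty convex values, is bounded and
has closed graph. -/
structure IsFilippovOn (F : ℝ → X → Set X) (R : ℝ) : Prop where
  nonempty : ∀ t x, ‖x‖ ≤ R → (F t x).Nonempty
  convex : ∀ t x, ‖x‖ ≤ R → Convex ℝ (F t x)
  bounded : ∃ C : NNReal, ∀ t x, ‖x‖ ≤ R → ∀ y ∈ F t x, ‖y‖ ≤ C
  closed : IsClosed {p : (ℝ × X) × X | ‖p.1.2‖ ≤ R ∧ p.2 ∈ F p.1.1 p.1.2}

variable {F : ℝ → X → Set X} {H W : X → ℝ} {R : ℝ}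

namespace IsStrictLyapunovOn

theorem W_nonneg (h : IsStrictLyapunovOn F H W R) {x : X} (hx : ‖x‖ ≤ R) : 0 ≤ W x := by
  rcases eq_or_ne x 0 with rfl | h0
  · exact h.W_zero.ge
  · exact (h.pos x hx h0).2.le

theorem H_nonneg (h : IsStrictLyapunovOn F H W R) {x : X} (hx : ‖x‖ ≤ R) : 0 ≤ H x := by
  rcases eq_or_ne x 0 with rfl | h0
  · exact h.H_zero.ge
  · exact (h.pos x hx h0).1.le

theorem isStrictLyapunov (h : IsStrictLyapunovOn F H W R) : IsStrictLyapunov F H := by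
  refine ⟨Metric.closedBall 0 R, Metric.closedBall_mem_nhds 0 h.radius_pos, W, h.continuousOn_H,
    h.continuousOn_W, h.H_zero, h.W_zero, fun x hx => h.pos x (mem_closedBall_zero_iff.1 hx), ?_⟩
  intro t₀ τ x hx hN s hs t ht hst
  exact h.decrease t₀ τ x hx s hs t ht hst fun z hz =>
    mem_closedBall_zero_iff.1 (hN z ⟨hs.1.trans hz.1, hz.2.trans_lt ht.2⟩)

theorem le_of_solution (h : IsStrictLyapunovOn F H W R) {t₀ τ : ℝ} {x : ℝ → X}
    (hx : IsSolutionOn F (Ico t₀ τ) x) {s t : ℝ} (hs : s ∈ Ico t₀ τ) (ht : t ∈ Ico t₀ τ)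
    (hst : s ≤ t) (hR : ∀ z ∈ Icc s t, ‖x z‖ ≤ R) : H (x t) ≤ H (x s) := by
  have h1 := h.decrease t₀ τ x hx s hs t ht hst hR
  have h2 : 0 ≤ ∫ z in s..t, W (x z) :=
    intervalIntegral.integral_nonneg hst fun z hz => h.W_nonneg (hR z hz)
  linarith

/-- With `μ` a positive lower bound of `H` on the sphere of radius `r`, a solution starting with `H
< μ` inside the sphere cannot reach it, as `H` does not increase up to the first hitting time. -/
theorem stable [ProperSpace X] (h : IsStrictLyapunovOn F H W R) {ε : ℝ} (hε : 0 < ε) :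
    ∃ δ > 0, ∀ (t₀ τ : ℝ) (x : ℝ → X), IsSolutionOn F (Ico t₀ τ) x →
      ‖x t₀‖ < δ → ∀ t ∈ Ico t₀ τ, ‖x t‖ < ε := by
  set r := min ε R
  have hr : 0 < r := lt_min hε h.radius_pos
  have hrR : r ≤ R := min_le_right _ _
  obtain ⟨μ, hμ, hμr⟩ := (isCompact_sphere (0 : X) r).exists_forall_le' (a := 0)
    (h.continuousOn_H.mono (Metric.sphere_subset_closedBall.trans
      (Metric.closedBall_subset_closedBall hrR))) fun x hx => by
      rw [mem_sphere_zero_iff_norm] at hx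
      exact (h.pos x (hx.le.trans hrR) (norm_pos_iff.1 (hx ▸ hr))).1
  have hH0 : ContinuousAt H 0 :=
    h.continuousOn_H.continuousAt (Metric.closedBall_mem_nhds 0 h.radius_pos)
  obtain ⟨δ, hδ, hδH⟩ := Metric.eventually_nhds_iff.1
    (hH0.eventually (gt_mem_nhds (h.H_zero.trans_lt hμ)))
  refine ⟨min δ r, lt_min hδ hr, fun t₀ τ x hx hx0 t ht => ?_⟩
  by_contra hcon
  have ht₀ : t₀ ∈ Ico t₀ τ := ⟨le_rfl, ht.1.trans_lt ht.2⟩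
  obtain ⟨c, hc, hcr, hbefore⟩ := exists_first_hitting (u := fun s => ‖x s‖) ht.1
    (hx.continuousOn ht₀ ht).norm (hx0.trans_le (min_le_right _ _))
    ((min_le_left _ _).trans (not_lt.1 hcon))
  have h1 := h.le_of_solution hx ht₀ ⟨hc.1, hc.2.trans_lt ht.2⟩ hc.1
    fun z hz => (hbefore z hz).trans hrR
  have h2 := hμr (x c) (mem_sphere_zero_iff_norm.2 hcr)
  have h3 : H (x t₀) < μ := hδH (by simpa using hx0.trans_le (min_le_left _ _))
  linarith

/-- Outside the `δ`-ball `W ≥ μ`, so `H`, which lies between `0` and `M`, could not fall for longer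
than `M / μ`. The solution therefore enters the `δ`-ball in time and stability keeps it within `ε`;
the bound does not depend on `t₀`. -/
theorem attractive [ProperSpace X] (h : IsStrictLyapunovOn F H W R) {r : ℝ}
    (hr : ∀ (t₀ τ : ℝ) (x : ℝ → X), IsSolutionOn F (Ico t₀ τ) x →
      ‖x t₀‖ < r → ∀ t ∈ Ico t₀ τ, ‖x t‖ < R) {ε : ℝ} (hε : 0 < ε) :
    ∃ S : ℝ, ∀ (t₀ τ : ℝ) (x : ℝ → X), IsSolutionOn F (Ico t₀ τ) x → ‖x t₀‖ < r →
      ∀ t ∈ Ico t₀ τ, t₀ + S ≤ t → ‖x t‖ < ε := by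
  obtain ⟨δ, hδ, hstab⟩ := h.stable hε
  obtain ⟨μ, hμ, hμW⟩ := ((isCompact_closedBall (0 : X) R).diff
    (Metric.isOpen_ball (x := (0 : X)) (ε := δ))).exists_forall_le' (a := 0)
    (h.continuousOn_W.mono sdiff_subset) fun x hx => by
      refine (h.pos x (mem_closedBall_zero_iff.1 hx.1) ?_).2
      rintro rfl
      exact hx.2 (Metric.mem_ball_self hδ)
  obtain ⟨M, hM⟩ := (isCompact_closedBall (0 : X) R).bddAbove_image h.continuousOn_H
  have hM : ∀ x, ‖x‖ ≤ R → H x ≤ M := fun x hx =>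
    hM (mem_image_of_mem _ (mem_closedBall_zero_iff.2 hx))
  have hM0 : 0 ≤ M := h.H_zero.ge.trans (hM 0 (by simpa using h.radius_pos.le))
  refine ⟨M / μ + 1, fun t₀ τ x hx hx0 t ht hSt => ?_⟩
  have hT : 0 ≤ M / μ := div_nonneg hM0 hμ.le
  have ht₀ : t₀ ∈ Ico t₀ τ := ⟨le_rfl, ht.1.trans_lt ht.2⟩
  have hR : ∀ z ∈ Icc t₀ t, ‖x z‖ ≤ R := fun z hz =>
    (hr t₀ τ x hx hx0 z ⟨hz.1, hz.2.trans_lt ht.2⟩).le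
  by_cases hex : ∃ s ∈ Icc t₀ t, ‖x s‖ < δ
  · obtain ⟨s, hs, hsδ⟩ := hex
    exact hstab s τ x (hx.mono (Ico_subset_Ico_left hs.1)) hsδ t ⟨hs.2, ht.2⟩
  · exfalso
    push Not at hex
    have hxc : ContinuousOn x (Icc t₀ t) := hx.continuousOn ht₀ ht
    have h1 := h.decrease t₀ τ x hx t₀ ht₀ t ht ht.1 hR
    have hWc : ContinuousOn (fun z => W (x z)) (uIcc t₀ t) := by
      rw [uIcc_of_le ht.1]
      exact h.continuousOn_W.comp hxc fun z hz => mem_closedBall_zero_iff.2 (hR z hz)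
    have h2 : ∫ _ in t₀..t, μ ≤ ∫ z in t₀..t, W (x z) :=
      intervalIntegral.integral_mono_on ht.1 intervalIntegrable_const hWc.intervalIntegrable
        fun z hz => hμW _ ⟨mem_closedBall_zero_iff.2 (hR z hz), by
          simpa using hex z hz⟩
    rw [intervalIntegral.integral_const, smul_eq_mul] at h2
    have h3 : (M / μ + 1) * μ ≤ (t - t₀) * μ := by gcongr; linarith
    rw [add_mul, div_mul_cancel₀ _ hμ.ne'] at h3
    have h4 := h.H_nonneg (hR t ⟨ht.1, le_rfl⟩)
    have h5 := hM _ (hR t₀ ⟨le_rfl, ht.1⟩)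
    linarith

end IsStrictLyapunovOn

/-- A solution of the truncated inclusion that cannot leave the ball solves the inclusion. -/
theorem IsFilippovOn.exists_solution [FiniteDimensional ℝ X] (hF : IsFilippovOn F R) (hR : 0 < R)
    {C : NNReal} (hC : ∀ t x, ‖x‖ ≤ R → ∀ y ∈ F t x, ‖y‖ ≤ C) {r : ℝ} (hrR : r ≤ R)
    (hr : ∀ (t₀ τ : ℝ) (x : ℝ → X), IsSolutionOn F (Ico t₀ τ) x →
      ‖x t₀‖ < r → ∀ t ∈ Ico t₀ τ, ‖x t‖ < R / 2) (t₀ : ℝ) {x₀ : X} (hx₀ : ‖x₀‖ < r) :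
    ∃ x : ℝ → X, x t₀ = x₀ ∧ LipschitzWith C x ∧
      ∀ᵐ t : ℝ, t₀ ≤ t → ∃ x', HasDerivAt x x' t ∧ x' ∈ F t (x t) := by
  obtain ⟨x, hx0, hxL, hxF⟩ := exists_lipschitz_solution (F := fun t x => F t (ballRetract R x))
    (C := C) (fun t x => hC t _ (norm_ballRetract_le hR x))
    (by
      have := hF.closed.preimage
        (f := fun p : (ℝ × X) × X => ((p.1.1, ballRetract R p.1.2), p.2))
        (by have := continuous_ballRetract (X := X) hR; fun_prop)
      convert this using 1
      ext p
      simp [norm_ballRetract_le hR])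
    (fun t x => hF.nonempty t _ (norm_ballRetract_le hR x))
    (fun t x => hF.convex t _ (norm_ballRetract_le hR x)) t₀ x₀
  have hbound : ∀ t, t₀ ≤ t → ‖x t‖ < R := by
    intro t ht
    by_contra hcon
    obtain ⟨c, hc, hcR, hbefore⟩ := exists_first_hitting (u := fun s => ‖x s‖) ht
      hxL.continuous.norm.continuousOn (by simpa [hx0] using hx₀.trans_le hrR) (not_lt.1 hcon)
    have hsol : IsSolutionOn F (Ico t₀ c) x := by
      refine ⟨fun a _ b _ _ => (hxL.lipschitzOnWith).absolutelyContinuousOnInterval, ?_⟩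
      filter_upwards [hxF] with s hs hsI
      obtain ⟨x', h1, h2⟩ := hs hsI.1
      rw [ballRetract_eq_self hR (hbefore s ⟨hsI.1, hsI.2.le⟩)] at h2
      exact ⟨x', h1, h2⟩
    have hlt := hr t₀ c x hsol (by rwa [hx0])
    rcases eq_or_lt_of_le hc.1 with rfl | hc1
    · rw [hx0] at hcR
      linarith
    -- The a priori bound covers only times before `c`. The margin between `R / 2` and `R` survives
    -- the limit and contradicts `‖x c‖ = R`.
    have : ‖x c‖ ≤ R / 2 := by
      refine le_of_tendsto (f := fun s => ‖x s‖) (x := 𝓝[<] c)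
        (hxL.continuous.norm.continuousAt.tendsto.mono_left nhdsWithin_le_nhds) ?_
      filter_upwards [Ioo_mem_nhdsLT hc1] with s hs
      exact (hlt s ⟨hs.1.le, hs.2⟩).le
    linarith
  refine ⟨x, hx0, hxL, ?_⟩
  filter_upwards [hxF] with t ht htI
  obtain ⟨x', h1, h2⟩ := ht htI
  rw [ballRetract_eq_self hR (hbound t htI).le] at h2
  exact ⟨x', h1, h2⟩

/-- The radii are nested: starts within `ρ` stay within `r / 2`, so the left limit at the end of the
interval lies within `r`, where existence can be invoked again to continue the solution. -/
theorem IsStrictLyapunovOn.isAsymptoticallyStable [FiniteDimensional ℝ X]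
    (h : IsStrictLyapunovOn F H W R) (hF : IsFilippovOn F R) : IsAsymptoticallyStable F := by
  have : ProperSpace X := FiniteDimensional.proper_real X
  have hR := h.radius_pos
  obtain ⟨C, hC⟩ := hF.bounded
  obtain ⟨r₁, hr₁, hst₁⟩ := h.stable (half_pos hR)
  set r := min r₁ R
  have hr : 0 < r := lt_min hr₁ hR
  have hst : ∀ (t₀ τ : ℝ) (x : ℝ → X), IsSolutionOn F (Ico t₀ τ) x →
      ‖x t₀‖ < r → ∀ t ∈ Ico t₀ τ, ‖x t‖ < R / 2 := fun t₀ τ x hx hx0 =>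
    hst₁ t₀ τ x hx (hx0.trans_le (min_le_left _ _))
  have hexist := fun t₀ x₀ hx₀ =>
    hF.exists_solution hR hC (min_le_right r₁ R) hst t₀ (x₀ := x₀) hx₀
  obtain ⟨ρ₁, hρ₁, hstρ₁⟩ := h.stable (half_pos hr)
  set ρ := min ρ₁ r
  have hρ : 0 < ρ := lt_min hρ₁ hr
  have hstρ : ∀ (t₀ τ : ℝ) (x : ℝ → X), IsSolutionOn F (Ico t₀ τ) x →
      ‖x t₀‖ < ρ → ∀ t ∈ Ico t₀ τ, ‖x t‖ < r / 2 := fun t₀ τ x hx hx0 =>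
    hstρ₁ t₀ τ x hx (hx0.trans_le (min_le_left _ _))
  have hrR : r ≤ R := min_le_right _ _
  refine ⟨fun ε hε => h.stable hε, ρ, hρ, ?_, ?_, fun ε hε => ?_⟩
  · intro t₀ x₀ hx₀
    obtain ⟨x, h1, h2, h3⟩ := hexist t₀ x₀ (hx₀.trans_le (min_le_right _ _))
    exact ⟨x, h1, fun a _ b _ _ => h2.lipschitzOnWith.absolutelyContinuousOnInterval, h3⟩
  · intro t₀ τ x hτ hx hx0
    have hxr := hstρ t₀ τ x hx hx0
    have hlip : LipschitzOnWith C x (Ico t₀ τ) := by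
      refine LipschitzOnWith.of_dist_le_mul fun s hs t ht => ?_
      wlog hst : s ≤ t generalizing s t
      · rw [dist_comm, dist_comm s]
        exact this t ht s hs (le_of_not_ge hst)
      rw [dist_comm, dist_comm s, dist_eq_norm, Real.dist_eq, abs_of_nonneg (sub_nonneg.2 hst)]
      refine (hx.1 s hs t ht hst).norm_sub_le hst C.2 ?_
      filter_upwards [hx.2] with z hz hzI
      have hzI' : z ∈ Ico t₀ τ := ⟨hs.1.trans hzI.1.le, hzI.2.trans ht.2⟩
      obtain ⟨x', h1, h2⟩ := hz hzI'
      exact ⟨x', h1, hC z (x z) (by linarith [hxr z hzI']) x' h2⟩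
    -- Bounded velocity makes the solution Lipschitz, so it extends to the endpoint `τ`.
    obtain ⟨g, hgL, hg⟩ := hlip.extend_finite_dimension
    have hgτ : ‖g τ‖ < r := by
      have : ‖g τ‖ ≤ r / 2 := by
        refine le_of_tendsto (f := fun s => ‖g s‖) (x := 𝓝[<] τ)
          (hgL.continuous.norm.continuousAt.tendsto.mono_left nhdsWithin_le_nhds) ?_
        filter_upwards [Ioo_mem_nhdsLT hτ] with s hs
        rw [← hg ⟨hs.1.le, hs.2⟩]
        exact (hxr s ⟨hs.1.le, hs.2⟩).le
      linarith
    obtain ⟨z, hz0, hzL, hzF⟩ := hexist τ (g τ) hgτ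
    -- This formula glues `g` and `z` at `τ` and is visibly Lipschitz, without splitting cases.
    set y : ℝ → X := fun t => g (min t τ) + z (max t τ) - g τ
    have hyg : ∀ t, t ≤ τ → y t = g t := fun t ht => by
      simp only [y, min_eq_left ht, max_eq_right ht, hz0, add_sub_cancel_right]
    have hyz : ∀ t, τ ≤ t → y t = z t := fun t ht => by
      simp only [y, min_eq_right ht, max_eq_left ht, add_sub_cancel_left]
    have hyL : LipschitzWith (lipschitzExtensionConstant X * C * 1 + C * 1 + 0) y :=
      ((hgL.comp (LipschitzWith.id.min_const τ)).add (hzL.comp (LipschitzWith.id.max_const τ))).sub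
        (LipschitzWith.const _)
    refine ⟨y, fun s hs => (hyg s hs.2.le).trans (hg hs).symm,
      fun a _ b _ _ => hyL.lipschitzOnWith.absolutelyContinuousOnInterval, ?_⟩
    filter_upwards [hx.2, hzF, compl_mem_ae_iff.2 (measure_singleton τ),
      compl_mem_ae_iff.2 (measure_singleton t₀)] with t h1 h2 h3 h4 h5
    have h5 : t₀ < t := lt_of_le_of_ne h5 (Ne.symm h4)
    rcases lt_or_gt_of_ne h3 with h6 | h6
    · obtain ⟨x', hx', hmem⟩ := h1 ⟨h5.le, h6⟩
      have hyx : y t = x t := (hyg t h6.le).trans (hg ⟨h5.le, h6⟩).symm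
      refine ⟨x', hx'.congr_of_eventuallyEq ?_, hyx ▸ hmem⟩
      filter_upwards [Ioo_mem_nhds h5 h6] with s hs
      exact (hyg s hs.2.le).trans (hg ⟨hs.1.le, hs.2⟩).symm
    · obtain ⟨z', hz', hmem⟩ := h2 h6.le
      refine ⟨z', hz'.congr_of_eventuallyEq ?_, (hyz t h6.le).symm ▸ hmem⟩
      filter_upwards [Ioi_mem_nhds h6] with s hs
      exact hyz s hs.le
  · exact h.attractive (fun t₀ τ x hx hx0 t ht =>
      (hstρ t₀ τ x hx hx0 t ht).trans (by linarith)) hε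

end Lyapunov

/-! ### The closed loop as a port-Hamiltonian system -/

section PortHamiltonian

variable {m : ℕ}

theorem isInvertible_adjoint {A : Mat m} (hA : A.IsInvertible) : (A†).IsInvertible := by
  refine ContinuousLinearMap.IsInvertible.of_inverse (g := A.inverse†) ?_ ?_
  · rw [← ContinuousLinearMap.adjoint_comp, hA.inverse_comp_self, ContinuousLinearMap.adjoint_id]
  · rw [← ContinuousLinearMap.adjoint_comp, hA.self_comp_inverse, ContinuousLinearMap.adjoint_id]

theorem hasStrictFDerivAt_half_norm_sq_snd (x : Phase m) :
    HasStrictFDerivAt (fun y : Phase m => 1 / 2 * ‖y.snd‖ ^ 2)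
      (innerSL ℝ x.snd ∘L WithLp.sndL 2 ℝ (Vec m) (Vec m)) x := by
  have h1 := (hasStrictFDerivAt_norm_sq x.snd).comp x
    (WithLp.sndL 2 ℝ (Vec m) (Vec m)).hasStrictFDerivAt
  refine (h1.const_mul (1 / 2 : ℝ)).congr_fderiv ?_
  ext v
  simp

theorem gradient_errorHamiltonian (x : Phase m) :
    gradient errorHamiltonian x = WithLp.toLp 2 (0, x.snd) := by
  refine HasGradientAt.gradient ?_
  rw [hasGradientAt_iff_hasFDerivAt]
  refine (hasStrictFDerivAt_half_norm_sq_snd x).hasFDerivAt.congr_fderiv ?_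
  ext v
  simp [WithLp.prod_inner_apply]

variable (P : Plant m) (qd : ℝ → Vec m) (φ : Vec m → Vec m → Vec m)

/-- The right-hand side of the closed loop in the configuration `q`, with `ξ` in the place of
`∇U(σ)`. -/
def loopField (q : Vec m) (x : Phase m) (ξ : Vec m) : Phase m :=
  WithLp.toLp 2 (P.T q x.snd,
    -(jacEta φ x).inverse (Lam P φ q x ξ) - (jacEta φ x).inverse (jacQ φ x (P.T q x.snd)))

theorem errorField_feedback (t : ℝ) (x : Phase m) (ξ : Vec m) :
    errorField P qd t x (feedback P qd φ t x ξ) = loopField P φ (config qd t x) x ξ := by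
  rw [errorField, gradient_errorHamiltonian, block, feedback, loopField, ← WithLp.toLp_add]
  congr 1
  ext1
  · simp
  · simp only [WithLp.toLp_fst, WithLp.toLp_snd, map_zero, zero_add, Prod.mk_add_mk, neg_apply]
    abel

/-- In the first row the `ξ`-terms cancel. In the second, after multiplying by `∂φ/∂η̃`, the skew
coupling and the damping block each supply one summand of `Λ̃`. -/
theorem smcStructure_gradient (hφq : ∀ x : Phase m, (jacQ φ x).IsInvertible)
    (hφη : ∀ x : Phase m, (jacEta φ x).IsInvertible) (t : ℝ) (x : Phase m) (ξ : Vec m) :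
    smcStructure P qd φ t x (WithLp.toLp 2 (((jacQ φ x)†) ξ, x.snd + ((jacEta φ x)†) ξ))
      = loopField P φ (config qd t x) x ξ := by
  have hinv : ((jacQ φ x)†).inverse (((jacQ φ x)†) ξ) = ξ :=
    (isInvertible_adjoint (hφq x)).inverse_apply_self ξ
  rw [smcStructure, block, loopField]
  congr 1
  ext1
  · simp [hinv]
  · apply (hφη x).injective
    simp only [WithLp.toLp_fst, WithLp.toLp_snd, Lam, map_add, map_sub, map_neg, neg_apply,
      ContinuousLinearMap.comp_apply, add_apply, (hφη x).self_apply_inverse]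
    abel

/-- The derivative of the sliding variable. -/
def slidingDeriv (x : Phase m) : Phase m →L[ℝ] Vec m :=
  jacQ φ x ∘L WithLp.fstL 2 ℝ (Vec m) (Vec m) + jacEta φ x ∘L WithLp.sndL 2 ℝ (Vec m) (Vec m)

theorem slidingDeriv_apply (x z : Phase m) :
    slidingDeriv φ x z = jacQ φ x z.fst + jacEta φ x z.snd := rfl

variable {φ}

theorem jacQ_eq (hφ : ContDiff ℝ 1 (fun x : Vec m × Vec m => φ x.1 x.2)) (x : Phase m) :
    jacQ φ x = fderiv ℝ (fun x : Vec m × Vec m => φ x.1 x.2) (x.fst, x.snd) ∘L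
      ContinuousLinearMap.inl ℝ (Vec m) (Vec m) := by
  have h := (hφ.differentiable one_ne_zero (x.fst, x.snd)).hasFDerivAt
  exact (HasFDerivAt.comp (f := fun a => (a, x.snd)) x.fst h
    (hasFDerivAt_prodMk_left x.fst x.snd)).fderiv

theorem jacEta_eq (hφ : ContDiff ℝ 1 (fun x : Vec m × Vec m => φ x.1 x.2)) (x : Phase m) :
    jacEta φ x = fderiv ℝ (fun x : Vec m × Vec m => φ x.1 x.2) (x.fst, x.snd) ∘L
      ContinuousLinearMap.inr ℝ (Vec m) (Vec m) := by
  have h := (hφ.differentiable one_ne_zero (x.fst, x.snd)).hasFDerivAt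
  exact (HasFDerivAt.comp (f := fun b => (x.fst, b)) x.snd h
    (hasFDerivAt_prodMk_right x.fst x.snd)).fderiv

theorem contDiff_slidingVar (hφ : ContDiff ℝ 1 (fun x : Vec m × Vec m => φ x.1 x.2)) :
    ContDiff ℝ 1 (slidingVar φ) :=
  hφ.comp (WithLp.prodContinuousLinearEquiv 2 ℝ (Vec m) (Vec m)).contDiff

theorem hasStrictFDerivAt_slidingVar (hφ : ContDiff ℝ 1 (fun x : Vec m × Vec m => φ x.1 x.2))
    (x : Phase m) : HasStrictFDerivAt (slidingVar φ) (slidingDeriv φ x) x := by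
  have h := (hφ.contDiffAt (x := (x.fst, x.snd))).hasStrictFDerivAt one_ne_zero
  have h2 := h.comp x
    (WithLp.prodContinuousLinearEquiv 2 ℝ (Vec m) (Vec m)).toContinuousLinearMap.hasStrictFDerivAt
  refine h2.congr_fderiv ?_
  ext1 z
  symm
  rw [slidingDeriv_apply, jacQ_eq hφ, jacEta_eq hφ]
  simp only [ContinuousLinearMap.comp_apply, ContinuousLinearMap.inl_apply,
    ContinuousLinearMap.inr_apply, ← map_add, Prod.mk_add_mk, add_zero, zero_add]
  rfl

theorem continuous_jacQ (hφ : ContDiff ℝ 1 (fun x : Vec m × Vec m => φ x.1 x.2)) :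
    Continuous (jacQ φ) := by
  have h := (hφ.continuous_fderiv one_ne_zero).comp
    (WithLp.prodContinuousLinearEquiv 2 ℝ (Vec m) (Vec m)).continuous
  exact (h.clm_comp continuous_const).congr fun x => (jacQ_eq hφ x).symm

theorem continuous_jacEta (hφ : ContDiff ℝ 1 (fun x : Vec m × Vec m => φ x.1 x.2)) :
    Continuous (jacEta φ) := by
  have h := (hφ.continuous_fderiv one_ne_zero).comp
    (WithLp.prodContinuousLinearEquiv 2 ℝ (Vec m) (Vec m)).continuous
  exact (h.clm_comp continuous_const).congr fun x => (jacEta_eq hφ x).symm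

theorem gradient_smcHamiltonian (hφ : ContDiff ℝ 1 (fun x : Vec m × Vec m => φ x.1 x.2))
    {U : Vec m → ℝ} {x : Phase m} (hU : DifferentiableAt ℝ U (slidingVar φ x)) :
    gradient (smcHamiltonian φ U) x =
      WithLp.toLp 2 (((jacQ φ x)†) (gradient U (slidingVar φ x)),
        x.snd + ((jacEta φ x)†) (gradient U (slidingVar φ x))) := by
  refine HasGradientAt.gradient ?_
  rw [hasGradientAt_iff_hasFDerivAt]
  have h1 := (hasStrictFDerivAt_half_norm_sq_snd x).hasFDerivAt
  have h2 := (hasGradientAt_iff_hasFDerivAt.1 hU.hasGradientAt).comp x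
    (hasStrictFDerivAt_slidingVar hφ x).hasFDerivAt
  refine (h1.add h2).congr_fderiv ?_
  ext v
  simp [WithLp.prod_inner_apply, slidingDeriv_apply, inner_add_left,
    ContinuousLinearMap.adjoint_inner_left]
  ring

/-- For `ζ` in the left side, `ζ - (0, η̃)` vanishes on the kernel of the derivative of `σ`, so it
factors through the adjoint of that derivative. The factor `ξ` is read off from the `η̃`-component.
-/
theorem clarkeGradient_smcHamiltonian (hφ : ContDiff ℝ 1 (fun x : Vec m × Vec m => φ x.1 x.2))
    (hφη : ∀ x : Phase m, (jacEta φ x).IsInvertible) {U : Vec m → ℝ} (hU : LocallyLipschitz U)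
    (x : Phase m) :
    clarkeGradient (smcHamiltonian φ U) x =
      (fun ξ => WithLp.toLp 2 (((jacQ φ x)†) ξ, x.snd + ((jacEta φ x)†) ξ)) ''
        clarkeGradient U (slidingVar φ x) := by
  have hsurj : Function.Surjective (slidingDeriv φ x) := fun w =>
    ⟨WithLp.toLp 2 (0, (jacEta φ x).inverse w), by
      simp [slidingDeriv_apply, (hφη x).self_apply_inverse]⟩
  have hderiv : ∀ v, clarkeDeriv (smcHamiltonian φ U) x v
      = ⟪x.snd, v.snd⟫_ℝ + clarkeDeriv U (slidingVar φ x) (slidingDeriv φ x v) := fun v =>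
    clarkeDeriv_add_comp hU (hasStrictFDerivAt_half_norm_sq_snd x)
      (hasStrictFDerivAt_slidingVar hφ x) hsurj v
  have hinner : ∀ ξ v, ⟪(WithLp.toLp 2 (((jacQ φ x)†) ξ, x.snd + ((jacEta φ x)†) ξ) : Phase m), v⟫_ℝ
      = ⟪x.snd, v.snd⟫_ℝ + ⟪ξ, slidingDeriv φ x v⟫_ℝ := by
    intro ξ v
    simp only [WithLp.prod_inner_apply, inner_add_left, ContinuousLinearMap.adjoint_inner_left,
      slidingDeriv_apply, inner_add_right, WithLp.ofLp_fst, WithLp.ofLp_snd]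
    ring
  ext ζ
  constructor
  · intro hζ
    have hK : ((jacEta φ x)†) (((jacEta φ x)†).inverse (ζ.snd - x.snd)) = ζ.snd - x.snd :=
      (isInvertible_adjoint (hφη x)).self_apply_inverse _
    set ξ := ((jacEta φ x)†).inverse (ζ.snd - x.snd)
    have hle : ∀ v, ⟪ζ, v⟫_ℝ - ⟪x.snd, v.snd⟫_ℝ
        ≤ clarkeDeriv U (slidingVar φ x) (slidingDeriv φ x v) := fun v => by
      have := hζ v
      rw [hderiv] at this
      linarith
    have hsnd : ∀ w : Vec m, ⟪ζ.snd, w⟫_ℝ = ⟪x.snd, w⟫_ℝ + ⟪ξ, jacEta φ x w⟫_ℝ := fun w => by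
      rw [← ContinuousLinearMap.adjoint_inner_left, hK, inner_sub_left]
      ring
    -- On the kernel the bound is `U°(σ; 0) = 0`; applying it to `v` and `-v` forces equality.
    have hker : ∀ v, slidingDeriv φ x v = 0 → ⟪ζ, v⟫_ℝ - ⟪x.snd, v.snd⟫_ℝ = 0 := by
      intro v hv
      have h1 := hle v
      have h2 := hle (-v)
      rw [map_neg, hv, neg_zero, clarkeDeriv_zero hU, inner_neg_right, WithLp.neg_snd,
        inner_neg_right] at h2
      rw [hv, clarkeDeriv_zero hU] at h1
      linarith
    have hfst : ζ.fst = ((jacQ φ x)†) ξ := by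
      refine ext_inner_right ℝ fun w => ?_
      have h1 := hker (WithLp.toLp 2 (w, -(jacEta φ x).inverse (jacQ φ x w))) (by
        simp [slidingDeriv_apply, (hφη x).self_apply_inverse])
      rw [WithLp.prod_inner_apply] at h1
      have h2 := hsnd (-(jacEta φ x).inverse (jacQ φ x w))
      rw [map_neg, (hφη x).self_apply_inverse, inner_neg_right ξ] at h2
      rw [ContinuousLinearMap.adjoint_inner_left]
      have h1 : ⟪ζ.fst, w⟫_ℝ + ⟪ζ.snd, -(jacEta φ x).inverse (jacQ φ x w)⟫_ℝ
        - ⟪x.snd, -(jacEta φ x).inverse (jacQ φ x w)⟫_ℝ = 0 := h1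
      linarith
    have hζξ : (WithLp.toLp 2 (((jacQ φ x)†) ξ, x.snd + ((jacEta φ x)†) ξ) : Phase m) = ζ := by
      rw [← hfst, hK, add_sub_cancel]
      rfl
    refine ⟨ξ, fun w => ?_, hζξ⟩
    obtain ⟨v, rfl⟩ := hsurj w
    have := hle v
    rw [← hζξ, hinner] at this
    linarith
  · rintro ⟨ξ, hξ, rfl⟩ v
    rw [hderiv, hinner]
    gcongr
    exact hξ _

end PortHamiltonian

/-! ### Solutions of the closed loop -/

section Solutions

variable {m : ℕ} {P : Plant m} {qd : ℝ → Vec m} {φ : Vec m → Vec m → Vec m} {U : Vec m → ℝ}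

theorem mem_closedLoop {t : ℝ} {x y : Phase m} :
    y ∈ closedLoop P qd φ U t x ↔
      ∃ ξ ∈ clarkeGradient U (slidingVar φ x), loopField P φ (config qd t x) x ξ = y := by
  simp only [closedLoop, mem_image, errorField_feedback]

/-- The last term of the feedback removes the drift `∂φ/∂q̃ T η̃`, leaving `σ̇ = -Λ̃ ξ`. -/
theorem slidingDeriv_loopField (hφη : ∀ x : Phase m, (jacEta φ x).IsInvertible) (q : Vec m)
    (x : Phase m) (ξ : Vec m) :
    slidingDeriv φ x (loopField P φ q x ξ) = -Lam P φ q x ξ := by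
  simp only [slidingDeriv_apply, loopField, WithLp.toLp_fst, WithLp.toLp_snd, map_sub, map_neg,
    (hφη x).self_apply_inverse]
  abel

theorem inner_Lam_self (q : Vec m) (x : Phase m) (u : Vec m) :
    ⟪Lam P φ q x u, u⟫_ℝ = 2 * ⟪u, jacQ φ x (P.T q (((jacEta φ x)†) u))⟫_ℝ := by
  simp only [Lam, add_apply, ContinuousLinearMap.comp_apply, inner_add_left]
  rw [← ContinuousLinearMap.adjoint_inner_right (jacEta φ x),
    ContinuousLinearMap.adjoint_inner_left, ContinuousLinearMap.adjoint_inner_left,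
    real_inner_comm u]
  ring

theorem inner_Lam_comm (q : Vec m) (x : Phase m) (u v : Vec m) :
    ⟪Lam P φ q x u, v⟫_ℝ = ⟪Lam P φ q x v, u⟫_ℝ := by
  simp only [Lam, add_apply, ContinuousLinearMap.comp_apply, inner_add_left]
  rw [← ContinuousLinearMap.adjoint_inner_right (jacEta φ x),
    ContinuousLinearMap.adjoint_inner_left, ContinuousLinearMap.adjoint_inner_left,
    ← ContinuousLinearMap.adjoint_inner_right (jacEta φ x) _ u,
    ContinuousLinearMap.adjoint_inner_left, ContinuousLinearMap.adjoint_inner_left,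
    real_inner_comm v, real_inner_comm u, add_comm]

/-- The power balance of the closed loop. -/
theorem inner_snd_loopField (hφη : ∀ x : Phase m, (jacEta φ x).IsInvertible) (q : Vec m)
    (x : Phase m) (ξ u : Vec m) (hu : ((jacEta φ x)†) u = x.snd) :
    ⟪x.snd, (loopField P φ q x ξ).snd⟫_ℝ - ⟪Lam P φ q x ξ, ξ⟫_ℝ
      = -(1 / 2) * (⟪Lam P φ q x ξ, ξ⟫_ℝ + ⟪Lam P φ q x (u + ξ), u + ξ⟫_ℝ) := by
  -- Substituting `η̃ = (∂φ/∂η̃)ᵀ u` turns the damping term into half the quadratic form of `Λ̃` at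
  -- `u`; the square is then completed using the symmetry of `Λ̃`.
  have h1 : ⟪x.snd, (loopField P φ q x ξ).snd⟫_ℝ
      = -⟪Lam P φ q x ξ, u⟫_ℝ - 1 / 2 * ⟪Lam P φ q x u, u⟫_ℝ := by
    rw [inner_Lam_self, hu]
    simp only [loopField, WithLp.toLp_snd, inner_sub_right, inner_neg_right]
    have hK : ∀ w, ⟪x.snd, (jacEta φ x).inverse w⟫_ℝ = ⟪u, w⟫_ℝ := fun w => by
      rw [← hu, ContinuousLinearMap.adjoint_inner_left, (hφη x).self_apply_inverse]
    rw [hK, hK, real_inner_comm u]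
    ring
  rw [h1, map_add, inner_add_left, inner_add_right, inner_add_right, inner_Lam_comm q x u ξ]
  ring

variable {ε : ℝ}

theorem le_inner_Lam
    (hΛ : ∀ (q : Vec m) (x : Phase m) (z : Vec m), z ≠ 0 → ε * ‖z‖ ^ 2 < ⟪Lam P φ q x z, z⟫_ℝ)
    (q : Vec m) (x : Phase m) (z : Vec m) : ε * ‖z‖ ^ 2 ≤ ⟪Lam P φ q x z, z⟫_ℝ := by
  rcases eq_or_ne z 0 with rfl | hz
  · simp
  · exact (hΛ q x z hz).le

variable {c ρ : ℝ} {x : ℝ → Phase m} {t₀ τ : ℝ}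

theorem IsSlidingPotential.nonneg (hU : IsSlidingPotential U c ρ) (σ : Vec m) : 0 ≤ U σ := by
  rcases eq_or_ne σ 0 with rfl | h0
  · exact hU.zero.ge
  · exact (hU.pos σ h0).le

theorem hasDerivAt_comp_of_hasFDerivAt {X Y : Type*} [NormedAddCommGroup X] [NormedSpace ℝ X]
    [NormedAddCommGroup Y] [NormedSpace ℝ Y] {f : X → Y} {L : X →L[ℝ] Y} {x : ℝ → X} {x' : X}
    {t : ℝ} (hf : HasFDerivAt f L (x t)) (hx : HasDerivAt x x' t) :
    HasDerivAt (fun s => f (x s)) (L x') t :=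
  hf.comp_hasDerivAt t hx

/-- The chain-rule inequality for `U(σ)` comes from regularity where `σ ≠ 0`. At `σ = 0` regularity
is not assumed: there `σ̇ = 0` for almost every time, so `Λ̃ ξ = 0` and `ξ = 0`, while `U(σ)` has a
minimum and zero derivative. -/
theorem ae_solution (hφ : ContDiff ℝ 1 (fun x : Vec m × Vec m => φ x.1 x.2))
    (hφη : ∀ x : Phase m, (jacEta φ x).IsInvertible) (hU : IsSlidingPotential U c ρ) (hε : 0 < ε)
    (hΛ : ∀ (q : Vec m) (x : Phase m) (z : Vec m), z ≠ 0 → ε * ‖z‖ ^ 2 < ⟪Lam P φ q x z, z⟫_ℝ)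
    {I : Set ℝ} (hx : IsSolutionOn (closedLoop P qd φ U) I x) :
    ∀ᵐ t : ℝ, t ∈ I → ∃ ξ ∈ clarkeGradient U (slidingVar φ (x t)),
      HasDerivAt (fun s => (x s).snd) (loopField P φ (config qd t (x t)) (x t) ξ).snd t ∧
      (slidingVar φ (x t) = 0 → ξ = 0) ∧
      ∀ V', HasDerivAt (fun s => U (slidingVar φ (x s))) V' t →
        V' ≤ -⟪Lam P φ (config qd t (x t)) (x t) ξ, ξ⟫_ℝ := by
  filter_upwards [hx.2, ae_eq_zero_of_hasDerivAt (fun t => slidingVar φ (x t))] with t h1 h2 ht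
  obtain ⟨x', hx', hmem⟩ := h1 ht
  obtain ⟨ξ, hξ, rfl⟩ := mem_closedLoop.1 hmem
  have hσ : HasDerivAt (fun t => slidingVar φ (x t))
      (-Lam P φ (config qd t (x t)) (x t) ξ) t := by
    rw [← slidingDeriv_loopField hφη]
    exact hasDerivAt_comp_of_hasFDerivAt (hasStrictFDerivAt_slidingVar hφ (x t)).hasFDerivAt hx'
  have hzero : slidingVar φ (x t) = 0 → ξ = 0 := by
    intro h0
    by_contra hne
    have h3 := hΛ (config qd t (x t)) (x t) ξ hne
    rw [neg_eq_zero.1 (h2 h0 _ hσ), inner_zero_left] at h3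
    have : 0 ≤ ε * ‖ξ‖ ^ 2 := by positivity
    linarith
  have hη : HasDerivAt (fun s => (x s).snd) (loopField P φ (config qd t (x t)) (x t) ξ).snd t :=
    hasDerivAt_comp_of_hasFDerivAt (WithLp.sndL 2 ℝ (Vec m) (Vec m)).hasFDerivAt hx'
  refine ⟨ξ, hξ, hη, hzero, fun V' hV' => ?_⟩
  by_cases h0 : slidingVar φ (x t) = 0
  · have hmin : IsLocalMin (fun s => U (slidingVar φ (x s))) t :=
      Eventually.of_forall fun s => by
        simpa [h0, hU.zero] using hU.nonneg (slidingVar φ (x s))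
    rw [hmin.hasDerivAt_eq_zero hV', hzero h0]
    simp
  · have := deriv_le_inner_of_clarkeRegularAt hU.lipschitz
      (γ := fun t => slidingVar φ (x t)) (hU.regular _ h0) hσ hV' hξ
    rwa [inner_neg_right, real_inner_comm] at this

theorem locallyLipschitz_potential (hφ : ContDiff ℝ 1 (fun x : Vec m × Vec m => φ x.1 x.2))
    (hU : LocallyLipschitz U) : LocallyLipschitz fun x : Phase m => U (slidingVar φ x) :=
  hU.comp (contDiff_slidingVar hφ).locallyLipschitz

theorem locallyLipschitz_smcHamiltonian (hφ : ContDiff ℝ 1 (fun x : Vec m × Vec m => φ x.1 x.2))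
    (hU : LocallyLipschitz U) : LocallyLipschitz (smcHamiltonian φ U) := by
  have h1 : ContDiff ℝ 1 (fun y : Phase m => 1 / 2 * ‖y.snd‖ ^ 2) :=
    contDiff_const.mul ((WithLp.sndL 2 ℝ (Vec m) (Vec m)).contDiff.norm_sq ℝ)
  exact h1.locallyLipschitz.add (locallyLipschitz_potential hφ hU)

/-- The sliding variable vanishes after a finite time that depends on the initial state only. -/
theorem slidingVar_eq_zero_of_le (hφ : ContDiff ℝ 1 (fun x : Vec m × Vec m => φ x.1 x.2))
    (hφη : ∀ x : Phase m, (jacEta φ x).IsInvertible) (hU : IsSlidingPotential U c ρ) (hε : 0 < ε)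
    (hΛ : ∀ (q : Vec m) (x : Phase m) (z : Vec m), z ≠ 0 → ε * ‖z‖ ^ 2 < ⟪Lam P φ q x z, z⟫_ℝ)
    (hx : IsSolutionOn (closedLoop P qd φ U) (Ico t₀ τ) x) {t : ℝ} (ht : t ∈ Ico t₀ τ)
    (hSt : t₀ + U (slidingVar φ (x t₀)) ^ (1 - 2 * ρ) / ((1 - 2 * ρ) * (ε * c ^ 2)) ≤ t) :
    slidingVar φ (x t) = 0 := by
  by_contra hne
  set V : ℝ → ℝ := fun s => U (slidingVar φ (x s))
  have hα : 0 < 1 - 2 * ρ := by linarith [hU.rho_lt]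
  have hc := hU.c_pos
  have ht₀ : t₀ ∈ Ico t₀ τ := ⟨le_rfl, ht.1.trans_lt ht.2⟩
  have hae := ae_solution hφ hφη hU hε hΛ hx
  have hVac : ∀ s ∈ Icc t₀ t, AbsolutelyContinuousOnInterval V s t := fun s hs =>
    (hx.1 s ⟨hs.1, hs.2.trans_lt ht.2⟩ t ht hs.2).comp_locallyLipschitz
      (locallyLipschitz_potential hφ hU.lipschitz)
  have hVt : 0 < V t := hU.pos _ hne
  have hmono : ∀ s ∈ Icc t₀ t, V t ≤ V s := by
    intro s hs
    have := (hVac s hs).sub_le_integral hs.2 (w := fun _ => 0) intervalIntegrable_const (by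
      filter_upwards [hae] with z hz hzI hd
      obtain ⟨ξ, -, -, -, hV⟩ := hz ⟨hs.1.trans hzI.1.le, hzI.2.trans ht.2⟩
      have h1 := hV _ hd.hasDerivAt
      have h2 := le_inner_Lam hΛ (config qd z (x z)) (x z) ξ
      have h3 : 0 ≤ ε * ‖ξ‖ ^ 2 := by positivity
      linarith)
    simp only [intervalIntegral.integral_zero] at this
    linarith
  -- The power need not be Lipschitz at `0`. This is harmless: `V` is nonincreasing, so before `t`
  -- it stays above `V t > 0`.
  have hpow : LocallyLipschitzOn (Ioi 0) fun y : ℝ => y ^ (1 - 2 * ρ) := by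
    intro y hy
    obtain ⟨K, s, hs, hK⟩ := (Real.contDiffAt_rpow_const_of_ne (n := 1) (p := 1 - 2 * ρ)
      (ne_of_gt hy)).exists_lipschitzOnWith
    exact ⟨K, s, mem_nhdsWithin_of_mem_nhds hs, hK⟩
  have hg := ((hVac t₀ ⟨le_rfl, ht.1⟩).comp_locallyLipschitzOn hpow fun s hs =>
    hVt.trans_le (hmono s (by rwa [uIcc_of_le ht.1] at hs))).sub_le_integral ht.1
    (w := fun _ => -((1 - 2 * ρ) * (ε * c ^ 2))) intervalIntegrable_const (by
      filter_upwards [hae, (hVac t₀ ⟨le_rfl, ht.1⟩).ae_differentiableAt] with z hz hzd hzI _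
      obtain ⟨ξ, hξ, -, -, hV⟩ := hz ⟨hzI.1.le, hzI.2.trans ht.2⟩
      have hd := hzd (by rw [uIcc_of_le ht.1]; exact Ioo_subset_Icc_self hzI)
      have hVz : 0 < V z := hVt.trans_le (hmono z (Ioo_subset_Icc_self hzI))
      have hσz : slidingVar φ (x z) ≠ 0 := fun h0 => by
        simp only [V, h0, hU.zero, lt_irrefl] at hVz
      have h1 := hV _ hd.hasDerivAt
      have h2 := le_inner_Lam hΛ (config qd z (x z)) (x z) ξ
      have h3 := hU.gradient_bound _ hσz ξ hξ
      have h4 : (c * V z ^ ρ) ^ 2 ≤ ‖ξ‖ ^ 2 := by gcongr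
      rw [mul_pow, ← Real.rpow_natCast (V z ^ ρ), ← Real.rpow_mul hVz.le] at h4
      have h5 : deriv V z ≤ -(ε * (c ^ 2 * V z ^ (ρ * (2 : ℕ)))) := by
        have : ε * (c ^ 2 * V z ^ (ρ * (2 : ℕ))) ≤ ε * ‖ξ‖ ^ 2 := by gcongr
        linarith
      -- The exponent `1 - 2ρ` is chosen so that the factor `V^(-2ρ)` from differentiation cancels
      -- the `V^(2ρ)` of the decay estimate.
      have h6 := hd.hasDerivAt.rpow_const (p := 1 - 2 * ρ) (Or.inl hVz.ne')
      rw [h6.deriv]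
      have h7 : V z ^ (1 - 2 * ρ - 1) * V z ^ (ρ * (2 : ℕ)) = 1 := by
        rw [← Real.rpow_add hVz]
        push_cast
        ring_nf
        exact Real.rpow_zero _
      have h8 : 0 < V z ^ (1 - 2 * ρ - 1) := Real.rpow_pos_of_pos hVz _
      calc deriv V z * (1 - 2 * ρ) * V z ^ (1 - 2 * ρ - 1)
          ≤ -(ε * (c ^ 2 * V z ^ (ρ * (2 : ℕ)))) * (1 - 2 * ρ) * V z ^ (1 - 2 * ρ - 1) := by
            gcongr
        _ = -((1 - 2 * ρ) * (ε * c ^ 2)) * (V z ^ (1 - 2 * ρ - 1) * V z ^ (ρ * (2 : ℕ))) := by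
            ring
        _ = -((1 - 2 * ρ) * (ε * c ^ 2)) := by rw [h7, mul_one])
  rw [intervalIntegral.integral_const, smul_eq_mul] at hg
  have hk : 0 < (1 - 2 * ρ) * (ε * c ^ 2) := by positivity
  have h1 : V t₀ ^ (1 - 2 * ρ) ≤ (t - t₀) * ((1 - 2 * ρ) * (ε * c ^ 2)) := by
    rw [← div_le_iff₀ hk]
    linarith
  have h2 : 0 < V t ^ (1 - 2 * ρ) := Real.rpow_pos_of_pos hVt _
  linarith

end Solutions

/-! ### Stability of the closed loop -/

section Stability

variable {m : ℕ} {P : Plant m} {qd : ℝ → Vec m} {φ : Vec m → Vec m → Vec m} {U : Vec m → ℝ}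
  {ε c ρ : ℝ}

/-- The dissipation dominates the Hamiltonian where `U ≤ 1` and `∂φ/∂η̃` is bounded. -/
theorem dissipation_le (hU : IsSlidingPotential U c ρ) (hε : 0 < ε) {κ : ℝ} (hκ : 0 < κ)
    {x : Phase m} (hK : ‖jacEta φ x‖ ≤ κ) (hU1 : U (slidingVar φ x) ≤ 1) {ξ u : Vec m}
    (hξ : ξ ∈ clarkeGradient U (slidingVar φ x)) (hu : ((jacEta φ x)†) u = x.snd) :
    ε / 4 * min (1 / κ ^ 2) (c ^ 2) * smcHamiltonian φ U x
      ≤ 1 / 2 * (ε * ‖ξ‖ ^ 2 + ε * ‖u + ξ‖ ^ 2) := by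
  have hc := hU.c_pos
  have hgrad : c ^ 2 * U (slidingVar φ x) ≤ ‖ξ‖ ^ 2 := by
    by_cases h0 : slidingVar φ x = 0
    · rw [h0, hU.zero, mul_zero]
      positivity
    · have h1 := hU.gradient_bound _ h0 ξ hξ
      have hpos := hU.pos _ h0
      -- Since `0 < U ≤ 1` and `2ρ < 1`, lowering the exponent from `1` to `2ρ` increases the power.
      have h2 : U (slidingVar φ x) ≤ (U (slidingVar φ x) ^ ρ) ^ 2 := by
        rw [← Real.rpow_natCast, ← Real.rpow_mul hpos.le]
        conv_lhs => rw [← Real.rpow_one (U (slidingVar φ x))]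
        refine Real.rpow_le_rpow_of_exponent_ge hpos hU1 ?_
        push_cast
        linarith [hU.rho_lt]
      calc c ^ 2 * U (slidingVar φ x) ≤ c ^ 2 * (U (slidingVar φ x) ^ ρ) ^ 2 := by gcongr
        _ = (c * U (slidingVar φ x) ^ ρ) ^ 2 := by ring
        _ ≤ ‖ξ‖ ^ 2 := by
          have : 0 ≤ c * U (slidingVar φ x) ^ ρ := by positivity
          gcongr
  have hb : ‖x.snd‖ ≤ κ * ‖u‖ := by
    rw [← hu]
    refine (ContinuousLinearMap.le_opNorm _ _).trans ?_
    rw [LinearIsometryEquiv.norm_map]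
    gcongr
  have hb2 : 1 / κ ^ 2 * ‖x.snd‖ ^ 2 ≤ ‖u‖ ^ 2 := by
    rw [one_div, inv_mul_le_iff₀ (by positivity), ← mul_pow]
    gcongr
  have hu2 : ‖u‖ ^ 2 ≤ 2 * (‖ξ‖ ^ 2 + ‖u + ξ‖ ^ 2) := by
    have h1 : ‖u‖ ≤ ‖u + ξ‖ + ‖ξ‖ := by
      simpa using norm_sub_le (u + ξ) ξ
    have h2 : ‖u‖ ^ 2 ≤ (‖u + ξ‖ + ‖ξ‖) ^ 2 := by gcongr
    nlinarith [sq_nonneg (‖u + ξ‖ - ‖ξ‖)]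
  have hσ := hU.nonneg (slidingVar φ x)
  have hH : min (1 / κ ^ 2) (c ^ 2) * smcHamiltonian φ U x ≤ 1 / 2 * ‖u‖ ^ 2 + ‖ξ‖ ^ 2 := by
    have h1 : min (1 / κ ^ 2) (c ^ 2) * ‖x.snd‖ ^ 2 ≤ ‖u‖ ^ 2 :=
      (mul_le_mul_of_nonneg_right (min_le_left _ _) (by positivity)).trans hb2
    have h2 : min (1 / κ ^ 2) (c ^ 2) * U (slidingVar φ x) ≤ ‖ξ‖ ^ 2 :=
      (mul_le_mul_of_nonneg_right (min_le_right _ _) hσ).trans hgrad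
    have h3 : smcHamiltonian φ U x = 1 / 2 * ‖x.snd‖ ^ 2 + U (slidingVar φ x) := rfl
    rw [h3]
    linarith
  have h4 : ε / 4 * (min (1 / κ ^ 2) (c ^ 2) * smcHamiltonian φ U x)
      ≤ ε / 4 * (2 * (‖ξ‖ ^ 2 + ‖u + ξ‖ ^ 2)) := by
    have : 0 ≤ ‖u + ξ‖ ^ 2 := by positivity
    exact mul_le_mul_of_nonneg_left (by linarith) (by positivity)
  linarith

theorem exists_isStrictLyapunovOn (hφ : ContDiff ℝ 1 (fun x : Vec m × Vec m => φ x.1 x.2))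
    (hφ0 : φ 0 0 = 0) (hφq : ∀ x : Phase m, (jacQ φ x).IsInvertible)
    (hφη : ∀ x : Phase m, (jacEta φ x).IsInvertible) (hU : IsSlidingPotential U c ρ) (hε : 0 < ε)
    (hΛ : ∀ (q : Vec m) (x : Phase m) (z : Vec m), z ≠ 0 → ε * ‖z‖ ^ 2 < ⟪Lam P φ q x z, z⟫_ℝ) :
    ∃ k R : ℝ, IsStrictLyapunovOn (closedLoop P qd φ U) (smcHamiltonian φ U)
      (fun x => k * smcHamiltonian φ U x) R := by
  have hc := hU.c_pos
  have hH := locallyLipschitz_smcHamiltonian hφ hU.lipschitz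
  set κ := ‖jacEta φ (0 : Phase m)‖ + 1
  have hκ : 0 < κ := by positivity
  have hK : ∀ᶠ x : Phase m in 𝓝 0, ‖jacEta φ x‖ ≤ κ :=
    ((continuous_jacEta hφ).norm.tendsto 0).eventually (ge_mem_nhds (lt_add_one _))
  have hσ0 : slidingVar φ (0 : Phase m) = 0 := hφ0
  have hU1 : ∀ᶠ x : Phase m in 𝓝 0, U (slidingVar φ x) ≤ 1 := by
    have h := (locallyLipschitz_potential hφ hU.lipschitz).continuous.tendsto (0 : Phase m)
    rw [hσ0, hU.zero] at h
    exact h.eventually (ge_mem_nhds one_pos)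
  -- Positive definiteness: invertibility of `∂φ/∂q̃` at the origin makes `0` an isolated zero of
  -- `φ(·, 0)`.
  have hinj : ∀ᶠ x : Phase m in 𝓝 0, x.fst ≠ 0 → φ x.fst 0 ≠ 0 := by
    have hd : HasFDerivAt (fun a => φ a 0) (jacQ φ (0 : Phase m)) 0 := by
      have h1 : DifferentiableAt ℝ (fun a => φ a 0) 0 :=
        ((hφ.comp (contDiff_prodMk_left (0 : Vec m))).differentiable one_ne_zero) 0
      exact h1.hasFDerivAt
    obtain ⟨e, he⟩ := hφq 0
    have h2 := hd.eventually_ne ⟨_, by rw [← he]; exact e.antilipschitz⟩ (c := 0)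
    rw [eventually_nhdsWithin_iff] at h2
    have h3 : Tendsto (fun x : Phase m => x.fst) (𝓝 0) (𝓝 0) :=
      (WithLp.fstL 2 ℝ (Vec m) (Vec m)).continuous.tendsto' 0 0 (map_zero _)
    exact h3.eventually h2
  obtain ⟨R, hR, hball⟩ := Metric.nhds_basis_closedBall.eventually_iff.1 (hK.and (hU1.and hinj))
  have hball : ∀ x : Phase m, ‖x‖ ≤ R → ‖jacEta φ x‖ ≤ κ ∧ U (slidingVar φ x) ≤ 1 ∧
      (x.fst ≠ 0 → φ x.fst 0 ≠ 0) := fun x hx => hball (mem_closedBall_zero_iff.2 hx)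
  set k := ε / 4 * min (1 / κ ^ 2) (c ^ 2)
  have hk : 0 < k := mul_pos (by positivity) (lt_min (by positivity) (by positivity))
  have hH0 : smcHamiltonian φ U (0 : Phase m) = 0 := by
    have : smcHamiltonian φ U (0 : Phase m)
        = 1 / 2 * ‖(0 : Phase m).snd‖ ^ 2 + U (slidingVar φ (0 : Phase m)) := rfl
    rw [this, hσ0, hU.zero]
    simp
  have hpos : ∀ x : Phase m, ‖x‖ ≤ R → x ≠ 0 → 0 < smcHamiltonian φ U x := by
    intro x hx hne
    have h1 : smcHamiltonian φ U x = 1 / 2 * ‖x.snd‖ ^ 2 + U (slidingVar φ x) := rfl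
    have h2 := hU.nonneg (slidingVar φ x)
    by_cases hb : x.snd = 0
    · have ha : x.fst ≠ 0 := fun ha => hne (by
        apply (WithLp.prodContinuousLinearEquiv 2 ℝ (Vec m) (Vec m)).injective
        exact Prod.ext ha hb)
      have h3 : slidingVar φ x ≠ 0 := by
        rw [slidingVar, hb]
        exact (hball x hx).2.2 ha
      have := hU.pos _ h3
      rw [h1]
      positivity
    · have : 0 < ‖x.snd‖ := norm_pos_iff.2 hb
      rw [h1]
      positivity
  refine ⟨k, R, hR, hH.continuous.continuousOn, (hH.continuous.const_mul k).continuousOn, hH0,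
    by rw [hH0, mul_zero], fun x hx hne => ⟨hpos x hx hne, mul_pos hk (hpos x hx hne)⟩, ?_⟩
  intro t₀ τ x hx s hs t ht hst hN
  have hac : AbsolutelyContinuousOnInterval (fun z => smcHamiltonian φ U (x z)) s t :=
    (hx.1 s hs t ht hst).comp_locallyLipschitz hH
  have hWint : IntervalIntegrable (fun z => -(k * smcHamiltonian φ U (x z))) volume s t :=
    (hac.continuousOn.const_mul k).neg.intervalIntegrable
  rw [← intervalIntegral.integral_neg]
  refine hac.sub_le_integral hst hWint ?_
  filter_upwards [ae_solution hφ hφη hU hε hΛ hx] with z hz hzI hd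
  obtain ⟨ξ, hξ, hη, -, hV⟩ := hz ⟨hs.1.trans hzI.1.le, hzI.2.trans ht.2⟩
  obtain ⟨hz1, hz2, -⟩ := hball (x z) (hN z (Ioo_subset_Icc_self hzI))
  have hkin : HasDerivAt (fun s => 1 / 2 * ‖(x s).snd‖ ^ 2)
      ⟪(x z).snd, (loopField P φ (config qd z (x z)) (x z) ξ).snd⟫_ℝ z := by
    refine (hη.norm_sq.const_mul (1 / 2 : ℝ)).congr_deriv ?_
    ring
  -- Differentiability of `U(σ)` in time is not automatic; it follows from that of the total and of
  -- the kinetic energy.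
  have hVd : HasDerivAt (fun s => U (slidingVar φ (x s))) _ z :=
    (hd.hasDerivAt.sub hkin).congr_of_eventuallyEq (Eventually.of_forall fun s => by
      simp [smcHamiltonian, slidingVar])
  have h1 := hV _ hVd
  have hu := (isInvertible_adjoint (hφη (x z))).self_apply_inverse (x z).snd
  set u := ((jacEta φ (x z))†).inverse (x z).snd
  have h2 := inner_snd_loopField (P := P) hφη (config qd z (x z)) (x z) ξ u hu
  have h3 : k * smcHamiltonian φ U (x z) ≤ 1 / 2 * (ε * ‖ξ‖ ^ 2 + ε * ‖u + ξ‖ ^ 2) :=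
    dissipation_le hU hε hκ hz1 hz2 hξ hu
  have h4 := le_inner_Lam hΛ (config qd z (x z)) (x z) ξ
  have h5 := le_inner_Lam hΛ (config qd z (x z)) (x z) (u + ξ)
  linarith

theorem continuous_loopField (hφ : ContDiff ℝ 1 (fun x : Vec m × Vec m => φ x.1 x.2))
    (hφη : ∀ x : Phase m, (jacEta φ x).IsInvertible) :
    Continuous fun p : Vec m × Phase m × Vec m => loopField P φ p.1 p.2.1 p.2.2 := by
  have hT : Continuous P.T := P.T_differentiable.continuous
  have hJ := continuous_jacQ hφ
  have hK := continuous_jacEta hφ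
  have hKinv : Continuous fun x : Phase m => (jacEta φ x).inverse :=
    continuous_iff_continuousAt.2 fun x =>
      ((hφη x).contDiffAt_map_inverse (n := 0)).continuousAt.comp hK.continuousAt
  have hadj : Continuous fun A : Mat m => A† := LinearIsometryEquiv.continuous _
  have hsnd : Continuous fun x : Phase m => x.snd := WithLp.continuous_snd 2 _ _
  have hTb : Continuous fun p : Vec m × Phase m × Vec m => P.T p.1 p.2.1.snd := by fun_prop
  have hLam : Continuous fun p : Vec m × Phase m × Vec m => Lam P φ p.1 p.2.1 p.2.2 := by
    unfold Lam
    fun_prop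
  have hKinv' : Continuous fun p : Vec m × Phase m × Vec m => (jacEta φ p.2.1).inverse :=
    hKinv.comp (by fun_prop)
  exact (WithLp.prod_continuous_toLp 2 _ _).comp (hTb.prodMk
    ((hKinv'.clm_apply hLam).neg.sub (hKinv'.clm_apply (by fun_prop))))

/-- With `D` cancelled, time enters only through `q = q̃ + q^d(t)`. Boundedness of `q^d` confines
`q` to a compact set, so the bound on the field is uniform in time. -/
theorem isFilippovOn_closedLoop (hqd_bdd : Bornology.IsBounded (range qd)) (hqd : Continuous qd)
    (hφ : ContDiff ℝ 1 (fun x : Vec m × Vec m => φ x.1 x.2))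
    (hφη : ∀ x : Phase m, (jacEta φ x).IsInvertible) (hU : LocallyLipschitz U) (R : ℝ) :
    IsFilippovOn (closedLoop P qd φ U) R := by
  have hcont := continuous_loopField (P := P) hφ hφη
  have hσ : Continuous (slidingVar φ) := (contDiff_slidingVar hφ).continuous
  have hfst : Continuous fun x : Phase m => x.fst := WithLp.continuous_fst 2 _ _
  obtain ⟨L, hL0, hL⟩ := exists_norm_le_of_mem_clarkeGradient hU
    ((isCompact_closedBall (0 : Phase m) R).image hσ)
  have hL : ∀ x : Phase m, ‖x‖ ≤ R → ∀ ξ ∈ clarkeGradient U (slidingVar φ x), ‖ξ‖ ≤ L :=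
    fun x hx => hL _ (mem_image_of_mem _ (mem_closedBall_zero_iff.2 hx))
  refine ⟨fun t x _ => (nonempty_clarkeGradient hU _).image _, fun t x _ => ?_, ?_, ?_⟩
  · rintro y₁ h₁ y₂ h₂ a b ha hb hab
    obtain ⟨ξ₁, hξ₁, rfl⟩ := mem_closedLoop.1 h₁
    obtain ⟨ξ₂, hξ₂, rfl⟩ := mem_closedLoop.1 h₂
    refine mem_closedLoop.2 ⟨a • ξ₁ + b • ξ₂, convex_clarkeGradient U _ hξ₁ hξ₂ ha hb hab, ?_⟩
    simp only [loopField, map_add, map_smul, ← WithLp.toLp_smul, ← WithLp.toLp_add, Prod.smul_mk,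
      Prod.mk_add_mk, ← add_smul, hab, one_smul]
    congr 2
    simp only [smul_sub, smul_neg]
    generalize (jacEta φ x).inverse (jacQ φ x (P.T (config qd t x) x.snd)) = w
    have hw : w = a • w + b • w := by rw [← add_smul, hab, one_smul]
    conv_lhs => rw [hw]
    abel
  · obtain ⟨Q, hQ⟩ := hqd_bdd.exists_norm_le
    have hcomp : IsCompact (Metric.closedBall (0 : Vec m) (R + Q) ×ˢ
        Metric.closedBall (0 : Phase m) R ×ˢ Metric.closedBall (0 : Vec m) L) :=
      (isCompact_closedBall _ _).prod ((isCompact_closedBall _ _).prod (isCompact_closedBall _ _))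
    obtain ⟨C, hC⟩ := hcomp.exists_bound_of_continuousOn hcont.continuousOn
    refine ⟨C.toNNReal, fun t x hx y hy => ?_⟩
    obtain ⟨ξ, hξ, rfl⟩ := mem_closedLoop.1 hy
    refine le_trans (hC (config qd t x, x, ξ) ⟨?_, mem_closedBall_zero_iff.2 hx,
      mem_closedBall_zero_iff.2 (hL x hx ξ hξ)⟩) (Real.le_coe_toNNReal C)
    rw [mem_closedBall_zero_iff, config]
    have h1 : ‖x.fst‖ ≤ ‖x‖ := by
      have h2 := WithLp.prod_norm_sq_eq_of_L2 x
      refine (sq_le_sq₀ (norm_nonneg _) (norm_nonneg _)).1 ?_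
      linarith [sq_nonneg ‖x.snd‖]
    exact (norm_add_le _ _).trans (add_le_add (h1.trans hx) (hQ _ (mem_range_self t)))
  · set B : Set (Vec m) := Metric.closedBall 0 L
    have : CompactSpace B := isCompact_iff_compactSpace.1 (isCompact_closedBall 0 L)
    -- The graph is the projection of this closed set along the compact ball that contains every
    -- relevant `ξ`, hence closed.
    set S : Set (((ℝ × Phase m) × Phase m) × B) :=
      {p | ‖p.1.1.2‖ ≤ R ∧ (p.2 : Vec m) ∈ clarkeGradient U (slidingVar φ p.1.1.2) ∧
        loopField P φ (config qd p.1.1.1 p.1.1.2) p.1.1.2 p.2 = p.1.2}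
    have hS : IsClosed S := by
      refine IsClosed.inter ?_ (IsClosed.inter ?_ ?_)
      · exact isClosed_le (f := fun p : ((ℝ × Phase m) × Phase m) × B => ‖p.1.1.2‖)
          (by fun_prop) continuous_const
      · exact (isClosed_graph_clarkeGradient hU).preimage
          (f := fun p : ((ℝ × Phase m) × Phase m) × B => (slidingVar φ p.1.1.2, (p.2 : Vec m)))
          (by fun_prop)
      · refine isClosed_eq (hcont.comp (f := fun p : ((ℝ × Phase m) × Phase m) × B =>
          (config qd p.1.1.1 p.1.1.2, p.1.1.2, (p.2 : Vec m))) ?_) (by fun_prop)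
        unfold config
        fun_prop
    convert isClosedMap_fst_of_compactSpace S hS using 1
    ext p
    constructor
    · rintro ⟨h1, h2⟩
      obtain ⟨ξ, hξ, hp⟩ := mem_closedLoop.1 h2
      exact ⟨(p, ⟨ξ, mem_closedBall_zero_iff.2 (hL _ h1 ξ hξ)⟩), ⟨h1, hξ, hp⟩, rfl⟩
    · rintro ⟨⟨p, ξ⟩, ⟨h1, h2, h3⟩, rfl⟩
      exact ⟨h1, mem_closedLoop.2 ⟨ξ, h2, h3⟩⟩

end Stability

end PBSMC

end

/-! ### Assembly of the port-Hamiltonian form, finite-time reaching and stability. -/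

theorem mainTheorem3 {m : ℕ} (P : PBSMC.Plant m)
    (qd : ℝ → PBSMC.Vec m) (hqd_bdd : Bornology.IsBounded (Set.range qd))
    (hqd : Differentiable ℝ qd) (hqd' : Differentiable ℝ (deriv qd))
    (φ : PBSMC.Vec m → PBSMC.Vec m → PBSMC.Vec m)
    (hφ : ContDiff ℝ 1 (fun x : PBSMC.Vec m × PBSMC.Vec m => φ x.1 x.2))
    (hφ0 : φ 0 0 = 0)
    (hφq : ∀ x : PBSMC.Phase m, (PBSMC.jacQ φ x).IsInvertible)
    (hφη : ∀ x : PBSMC.Phase m, (PBSMC.jacEta φ x).IsInvertible) :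
    -- the closed loop is port-Hamiltonian, wherever `U` is differentiable
    (∀ (U : PBSMC.Vec m → ℝ) (t : ℝ) (x : PBSMC.Phase m),
      DifferentiableAt ℝ U (PBSMC.slidingVar φ x) →
      PBSMC.errorField P qd t x
          (PBSMC.feedback P qd φ t x (gradient U (PBSMC.slidingVar φ x))) =
        PBSMC.smcStructure P qd φ t x (gradient (PBSMC.smcHamiltonian φ U) x)) ∧
    -- and, for nonsmooth `U`, in the sense of generalized gradients
    (∀ U : PBSMC.Vec m → ℝ, LocallyLipschitz U → ∀ (t : ℝ) (x : PBSMC.Phase m),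
      PBSMC.closedLoop P qd φ U t x =
        PBSMC.smcStructure P qd φ t x ''
          PBSMC.clarkeGradient (PBSMC.smcHamiltonian φ U) x) ∧
    -- finite-time convergence of the sliding variable and asymptotic stability
    (∀ (U : PBSMC.Vec m → ℝ) (c ρ ε : ℝ), PBSMC.IsSlidingPotential U c ρ → 0 < ε →
      (∀ (q : PBSMC.Vec m) (x : PBSMC.Phase m) (z : PBSMC.Vec m), z ≠ 0 →
        ε * ‖z‖ ^ 2 < inner ℝ (PBSMC.Lam P φ q x z) z) →
      (∃ S : PBSMC.Phase m → ℝ, ∀ (t₀ τ : ℝ) (x : ℝ → PBSMC.Phase m),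
        PBSMC.IsSolutionOn (PBSMC.closedLoop P qd φ U) (Set.Ico t₀ τ) x →
        ∀ t ∈ Set.Ico t₀ τ, t₀ + S (x t₀) ≤ t → PBSMC.slidingVar φ (x t) = 0) ∧
      PBSMC.IsAsymptoticallyStable (PBSMC.closedLoop P qd φ U) ∧
      PBSMC.IsStrictLyapunov (PBSMC.closedLoop P qd φ U) (PBSMC.smcHamiltonian φ U)) := by
  refine ⟨fun U t x hU => ?_, fun U hU t x => ?_, fun U c ρ ε hU hε hΛ => ?_⟩
  · rw [PBSMC.errorField_feedback, PBSMC.gradient_smcHamiltonian hφ hU,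
      PBSMC.smcStructure_gradient P qd φ hφq hφη]
  · rw [PBSMC.clarkeGradient_smcHamiltonian hφ hφη hU, Set.image_image]
    simp only [PBSMC.smcStructure_gradient P qd φ hφq hφη, PBSMC.closedLoop,
      PBSMC.errorField_feedback]
  · obtain ⟨k, R, h⟩ := PBSMC.exists_isStrictLyapunovOn (qd := qd) hφ hφ0 hφq hφη hU hε hΛ
    exact ⟨⟨fun x => U (PBSMC.slidingVar φ x) ^ (1 - 2 * ρ) / ((1 - 2 * ρ) * (ε * c ^ 2)),
        fun t₀ τ x hx t ht hSt => PBSMC.slidingVar_eq_zero_of_le hφ hφη hU hε hΛ hx ht hSt⟩,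
      h.isAsymptoticallyStable
        (PBSMC.isFilippovOn_closedLoop hqd_bdd hqd.continuous hφ hφη hU.lipschitz R),
      h.isStrictLyapunov⟩
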